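/- Let $\ell\ge 1$, let $\epsilon\in\mathbb C$ be a primitive $\ell$-th root of unity, and let $c=(c_1,\dots,c_{\ell-1})\in\mathbb C^{\ell-1}$. **Dunkl side.** Let $\Gamma=\langle\alpha\rangle$ be the cyclic group of order $\ell$, acting on the free algebra $\mathbb C\langle x,y\rangle$ by $\alpha(x)=\epsilon x$, $\alpha(y)=\epsilon^{-1}y$. Let $H_1(c)$ be the quotient of $\Gamma\ltimes\mathbb C\langle x,y\rangle$ by the relation $[y,x]=1+\sum_{m=1}^{\ell-1}c_m\alpha^m$, and let $e=\frac1\ell\sum_{\gamma\in\Gamma}\gamma$. Put $\mathfrak t^{reg}=\mathbb C\setminus\{0\}$ with coordinate $x$ and let $\mathrm D(\mathfrak t^{reg})$ be its algebra of differential operators. Let $\Theta_c:H_1(c)\to\Gamma\ltimes \mathrm D(\mathfrak t^{reg})$ be the homomorphism with $x\mapsto x$, $\gamma\mapsto\gamma$ for $\gamma\in\Gamma$, and $$y\mapsto\frac{\partial}{\partial x}+\sum_{m=1}^{\ell-1}\frac{c_m}{(\epsilon^m-1)x}(\alpha^m-1).$$ The spherical Dunkl map $\Theta_c^{sph}:eH_1(c)e\to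 \mathrm D(\mathfrak t^{reg})^\Gamma$ sends $u$ to the operator $E$ with $\Theta_c(u)=Ee$. **Quiver side.** Let $RQ_1=\mathbb C^\ell$ be the space of representations of dimension $(1,\dots,1)$ of the cyclic quiver with $\ell$ vertices, with coordinates $A_{i,i+1}$, $i\in\{0,\dots,\ell-1\}$ modulo $\ell$. The group $(\mathbb C^*)^\ell$ acts on it by $A_{i,i+1}\mapsto g_iA_{i,i+1}g_{i+1}^{-1}$, the diagonal $\mathbb C^*$ acts trivially, and $\mathfrak{pg}_1=\mathbb C^\ell/\mathbb C$ is the Lie algebra of the quotient. For $\xi\in\mathfrak{pg}_1$ let $L_\xi=\sum_i(\xi_i-\xi_{i+1})A_{i,i+1}\frac{\partial}{\partial A_{i,i+1}}$ be the corresponding vector field, and let $\mathrm D(RQ_1)^{\mathfrak{pg}_1}$ be the algebra of polynomial differential operators on $RQ_1$ that commute with all $L_\xi$. Put $$C_0=\frac{1-\ell}{\ell}+\frac1\ell\sum_{m=1}^{\ell-1}c_m,\qquad C_i=\frac1\ell+\frac1\ell\sum_{m=1}^{\ell-1}\epsilon^{mi}c_m\quad(1\le i\le\ell-1),$$ $$\chi_c(\xi)=\sum_{i=0}^{\ell-1}C_i\xi_i,\qquad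 \sigma=-\frac1\ell\sum_{s=0}^{\ell-1}sC_s,\qquad r_i=-\sigma+\sum_{j=0}^iC_j.$$ Since $\sum_iC_i=0$, $\chi_c$ is a character of $\mathfrak{pg}_1$. Let $Fun_c$ be the space of multivalued functions $f=\tilde f\prod_iA_{i,i+1}^{r_i}$, with $\tilde f$ a rational function on $RQ_1$, such that $L_\xi f=\chi_c(\xi)f$ for all $\xi$, and let $Res(f)(x)=f(x,\dots,x)$. **Proposition.** For every $D\in \mathrm D(RQ_1)^{\mathfrak{pg}_1}$ there is a unique $\mathfrak R_c(D)\in \mathrm D(\mathfrak t^{reg})$ with $Res(Df)=\mathfrak R_c(D)\,Res(f)$ for all $f\in Fun_c$. Put $\mathfrak R_c^{tw}(D)=x^{-\ell\sigma}\circ\mathfrak R_c(D)\circ x^{\ell\sigma}$. Then $$\mathfrak R_c^{tw}\bigl(\mathrm D(RQ_1)^{\mathfrak{pg}_1}\bigr)=\Theta_c^{sph}\bigl(eH_1(c)e\bigr)$$ as subsets of $\mathrm D(\mathfrak t^{reg})$. -/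

import Mathlib

noncomputable section

namespace CyclicQuiver

open scoped Polynomial

/-! ### Derivations of fields of fractions -/

section FracDeriv

variable {A : Type*} [CommRing A] [IsDomain A] [Algebra ℂ A]

/-- The ring homomorphism `a ↦ a + d(a) ε` from `A` to the dual numbers over `Frac A`. -/
def toDual (d : Derivation ℂ A A) : A →+* DualNumber (FractionRing A) where
  toFun a := TrivSqZeroExt.inl (algebraMap A (FractionRing A) a)
    + TrivSqZeroExt.inr (algebraMap A (FractionRing A) (d a))
  map_one' := by simp
  map_zero' := by simp
  map_add' a b := by
    ext <;> simp only [map_add, TrivSqZeroExt.snd_add, TrivSqZeroExt.snd_inl, TrivSqZeroExt.snd_inr, TrivSqZeroExt.fst_add,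
        TrivSqZeroExt.fst_inl, TrivSqZeroExt.fst_inr] <;> ring
  map_mul' a b := by
    ext
    · simp
    · simp only [map_add, map_mul, Derivation.leibniz, smul_eq_mul, DualNumber.snd_mul,
        TrivSqZeroExt.snd_add, TrivSqZeroExt.snd_inl, TrivSqZeroExt.snd_inr, TrivSqZeroExt.fst_add,
        TrivSqZeroExt.fst_inl, TrivSqZeroExt.fst_inr]
      ring

lemma toDual_isUnit (d : Derivation ℂ A A) (y : nonZeroDivisors A) : IsUnit (toDual d y) := by
  rw [TrivSqZeroExt.isUnit_iff_isUnit_fst]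
  simp [toDual]

/-- The extension of `toDual` to the field of fractions. -/
def fracDual (d : Derivation ℂ A A) : FractionRing A →+* DualNumber (FractionRing A) :=
  IsLocalization.lift (M := nonZeroDivisors A) (toDual_isUnit d)

lemma fracDual_algebraMap (d : Derivation ℂ A A) (a : A) :
    fracDual d (algebraMap A (FractionRing A) a) = toDual d a :=
  IsLocalization.lift_eq _ _

lemma fst_fracDual (d : Derivation ℂ A A) (f : FractionRing A) :
    TrivSqZeroExt.fst (fracDual d f) = f := by
  have h : ((TrivSqZeroExt.fstHom ℂ (FractionRing A) (FractionRing A)).toRingHom.comp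
      (fracDual d)) = RingHom.id _ := by
    apply IsLocalization.ringHom_ext (nonZeroDivisors A)
    ext a
    simp [fracDual_algebraMap, toDual]
  exact DFunLike.congr_fun h f

/-- The unique extension (by the quotient rule) of a derivation of `A` to the field of fractions
of `A`. -/
def fracDeriv (d : Derivation ℂ A A) : Derivation ℂ (FractionRing A) (FractionRing A) :=
  Derivation.mk'
    { toFun := fun f => TrivSqZeroExt.snd (fracDual d f)
      map_add' := fun f g => by simp
      map_smul' := fun z f => by
        have hz : fracDual d (algebraMap ℂ (FractionRing A) z)
            = TrivSqZeroExt.inl (algebraMap ℂ (FractionRing A) z) := by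
          rw [IsScalarTower.algebraMap_apply ℂ A (FractionRing A), fracDual_algebraMap]
          simp [toDual]
        rw [Algebra.smul_def, map_mul, hz, DualNumber.snd_mul]
        simp [Algebra.smul_def] }
    (fun f g => by
      simp [fst_fracDual, mul_comm])

lemma fracDeriv_algebraMap (d : Derivation ℂ A A) (a : A) :
    fracDeriv d (algebraMap A (FractionRing A) a) = algebraMap A (FractionRing A) (d a) := by
  change TrivSqZeroExt.snd (fracDual d _) = _
  rw [fracDual_algebraMap]
  change TrivSqZeroExt.snd (TrivSqZeroExt.inl (algebraMap A (FractionRing A) a)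
    + TrivSqZeroExt.inr (algebraMap A (FractionRing A) (d a))) = _
  rw [TrivSqZeroExt.snd_add, TrivSqZeroExt.snd_inl, TrivSqZeroExt.snd_inr, zero_add]

lemma derivation_frac_ext {d e : Derivation ℂ (FractionRing A) (FractionRing A)}
    (h : ∀ a : A, d (algebraMap A (FractionRing A) a) = e (algebraMap A (FractionRing A) a)) :
    d = e := by
  ext f
  obtain ⟨a, b, hb, rfl⟩ := IsFractionRing.div_surjective (A := A) f
  have hb' : algebraMap A (FractionRing A) b ≠ 0 := by
    simpa using nonZeroDivisors.ne_zero hb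
  have key : ∀ D : Derivation ℂ (FractionRing A) (FractionRing A),
      algebraMap A (FractionRing A) b * D (algebraMap A (FractionRing A) a
        / algebraMap A (FractionRing A) b) =
      D (algebraMap A (FractionRing A) a) - (algebraMap A (FractionRing A) a
        / algebraMap A (FractionRing A) b) * D (algebraMap A (FractionRing A) b) := by
    intro D
    have := D.leibniz (algebraMap A (FractionRing A) b)
      (algebraMap A (FractionRing A) a / algebraMap A (FractionRing A) b)
    rw [mul_div_cancel₀ _ hb'] at this
    rw [this]
    simp
  apply mul_left_cancel₀ hb'
  rw [key, key, h, h]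

lemma fracDeriv_comm (d e : Derivation ℂ A A) (h : ∀ a, d (e a) = e (d a)) (f : FractionRing A) :
    fracDeriv d (fracDeriv e f) = fracDeriv e (fracDeriv d f) := by
  have h0 : ⁅fracDeriv d, fracDeriv e⁆ = 0 := by
    apply derivation_frac_ext
    intro a
    simp [Derivation.commutator_apply, fracDeriv_algebraMap, h]
  have := DFunLike.congr_fun h0 f
  simpa [Derivation.commutator_apply, sub_eq_zero] using this

end FracDeriv

/-! ### Differential operators on affine space -/

/-- The defining relations of the Weyl algebra: `Sum.inl i` is the coordinate `a i` and `Sum.inr i`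
is the partial derivative `∂ i`. -/
inductive WeylRel (ι : Type) [DecidableEq ι] :
    FreeAlgebra ℂ (ι ⊕ ι) → FreeAlgebra ℂ (ι ⊕ ι) → Prop
  | coord (i j : ι) : WeylRel ι
      (FreeAlgebra.ι ℂ (Sum.inl i) * FreeAlgebra.ι ℂ (Sum.inl j))
      (FreeAlgebra.ι ℂ (Sum.inl j) * FreeAlgebra.ι ℂ (Sum.inl i))
  | deriv (i j : ι) : WeylRel ι
      (FreeAlgebra.ι ℂ (Sum.inr i) * FreeAlgebra.ι ℂ (Sum.inr j))
      (FreeAlgebra.ι ℂ (Sum.inr j) * FreeAlgebra.ι ℂ (Sum.inr i))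
  | mixed (i j : ι) : WeylRel ι
      (FreeAlgebra.ι ℂ (Sum.inr i) * FreeAlgebra.ι ℂ (Sum.inl j))
      (FreeAlgebra.ι ℂ (Sum.inl j) * FreeAlgebra.ι ℂ (Sum.inr i) + if i = j then 1 else 0)

/-- The algebra of (polynomial, linear) differential operators on the affine space with
coordinates `a i`, `i : ι`. -/
abbrev Weyl (ι : Type) [DecidableEq ι] : Type := RingQuot (WeylRel ι)

/-- The coordinate `a i` as a differential operator of order zero. -/
def Weyl.a {ι : Type} [DecidableEq ι] (i : ι) : Weyl ι :=
  RingQuot.mkAlgHom ℂ (WeylRel ι) (FreeAlgebra.ι ℂ (Sum.inl i))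

/-- The partial derivative `∂ / ∂ a i`. -/
def Weyl.d {ι : Type} [DecidableEq ι] (i : ι) : Weyl ι :=
  RingQuot.mkAlgHom ℂ (WeylRel ι) (FreeAlgebra.ι ℂ (Sum.inr i))

/-! ### Differential operators on `𝔱^reg = ℂ \ {0}` -/

/-- The generators of `D(ℂ \ {0})`: the coordinate, its inverse and the derivative. -/
inductive RegGen
  | x
  | xinv
  | d

/-- The defining relations `x x⁻¹ = x⁻¹ x = 1` and `∂ x = x ∂ + 1` of `D(ℂ \ {0})`. -/
inductive RegRel : FreeAlgebra ℂ RegGen → FreeAlgebra ℂ RegGen → Prop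
  | mul_inv : RegRel (FreeAlgebra.ι ℂ RegGen.x * FreeAlgebra.ι ℂ RegGen.xinv) 1
  | inv_mul : RegRel (FreeAlgebra.ι ℂ RegGen.xinv * FreeAlgebra.ι ℂ RegGen.x) 1
  | comm : RegRel (FreeAlgebra.ι ℂ RegGen.d * FreeAlgebra.ι ℂ RegGen.x)
      (FreeAlgebra.ι ℂ RegGen.x * FreeAlgebra.ι ℂ RegGen.d + 1)

/-- The algebra `D(𝔱^reg)` of algebraic differential operators on `𝔱^reg = ℂ \ {0}`. -/
abbrev DReg : Type := RingQuot RegRel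

namespace DReg

/-- The coordinate function. -/
def x : DReg := RingQuot.mkAlgHom ℂ RegRel (FreeAlgebra.ι ℂ RegGen.x)

/-- The inverse of the coordinate function. -/
def xinv : DReg := RingQuot.mkAlgHom ℂ RegRel (FreeAlgebra.ι ℂ RegGen.xinv)

/-- The derivative `∂ / ∂ x`. -/
def d : DReg := RingQuot.mkAlgHom ℂ RegRel (FreeAlgebra.ι ℂ RegGen.d)

lemma x_mul_xinv : x * xinv = 1 := by
  simpa [x, xinv] using RingQuot.mkAlgHom_rel ℂ RegRel.mul_inv

lemma xinv_mul_x : xinv * x = 1 := by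
  simpa [x, xinv] using RingQuot.mkAlgHom_rel ℂ RegRel.inv_mul

lemma d_mul_x : d * x = x * d + 1 := by
  simpa [x, d] using RingQuot.mkAlgHom_rel ℂ RegRel.comm

lemma d_mul_xinv : d * xinv = xinv * d - xinv * xinv := by
  have h : xinv * (d * x) * xinv = xinv * (x * d + 1) * xinv := by rw [d_mul_x]
  have h1 : xinv * (d * x) * xinv = xinv * d := by
    rw [mul_assoc, mul_assoc, x_mul_xinv, mul_one]
  have h2 : xinv * (x * d + 1) * xinv = d * xinv + xinv * xinv := by
    rw [mul_add, ← mul_assoc, xinv_mul_x, one_mul, mul_one, add_mul]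
  rw [h1, h2] at h
  rw [h]; abel

/-- An algebra homomorphism out of `D(𝔱^reg)` is given by the images of the generators. -/
def lift {B : Type*} [Ring B] [Algebra ℂ B] (X Y P : B) (h1 : X * Y = 1) (h2 : Y * X = 1)
    (h3 : P * X = X * P + 1) : DReg →ₐ[ℂ] B :=
  RingQuot.liftAlgHom ℂ ⟨FreeAlgebra.lift ℂ (fun g => match g with
    | RegGen.x => X
    | RegGen.xinv => Y
    | RegGen.d => P), by
      intro u v h
      cases h <;> simp [h1, h2, h3]⟩

section lift

variable {B : Type*} [Ring B] [Algebra ℂ B] (X Y P : B) (h1 : X * Y = 1) (h2 : Y * X = 1)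
    (h3 : P * X = X * P + 1)

@[simp] lemma lift_x : lift X Y P h1 h2 h3 x = X := by simp [lift, x]
@[simp] lemma lift_xinv : lift X Y P h1 h2 h3 xinv = Y := by simp [lift, xinv]
@[simp] lemma lift_d : lift X Y P h1 h2 h3 d = P := by simp [lift, d]

end lift

lemma hom_ext {B : Type*} [Ring B] [Algebra ℂ B] {f g : DReg →ₐ[ℂ] B} (h1 : f x = g x)
    (h2 : f xinv = g xinv) (h3 : f d = g d) : f = g := by
  apply RingQuot.ringQuot_ext'
  apply FreeAlgebra.hom_ext
  funext t
  cases t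
  · exact h1
  · exact h2
  · exact h3

/-- Conjugation `E ↦ x^{-μ} ∘ E ∘ x^μ` by the multivalued function `x^μ`. It fixes `x` and
sends `∂` to `∂ + μ / x`. -/
def conjPow (μ : ℂ) : DReg →ₐ[ℂ] DReg :=
  lift x xinv (d + μ • xinv) x_mul_xinv xinv_mul_x (by
    rw [add_mul, mul_add, d_mul_x, smul_mul_assoc, mul_smul_comm, xinv_mul_x, x_mul_xinv]
    abel)

/-- The automorphism of `D(𝔱^reg)` that sends `x` to `z x` and `∂` to `z⁻¹ ∂`. -/
def rot (z : ℂˣ) : DReg →ₐ[ℂ] DReg :=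
  lift ((z : ℂ) • x) (((z⁻¹ : ℂˣ) : ℂ) • xinv) (((z⁻¹ : ℂˣ) : ℂ) • d)
    (by rw [smul_mul_smul_comm, x_mul_xinv]; simp)
    (by rw [smul_mul_smul_comm, xinv_mul_x]; simp)
    (by rw [smul_mul_smul_comm, smul_mul_smul_comm, d_mul_x]; simp)

lemma rot_one : rot 1 = AlgHom.id ℂ DReg := by
  apply hom_ext <;> simp [rot]

lemma rot_mul (z w : ℂˣ) : rot (z * w) = (rot z).comp (rot w) := by
  apply hom_ext <;> simp [rot, smul_smul, mul_comm]

end DReg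

/-! ### The cyclic group `Γ` and its actions -/

/-- The cyclic group `Γ` of order `ℓ`, realized as the group of `ℓ`-th roots of unity; the element
`ζ` acts by `x ↦ ζ x`, `y ↦ ζ⁻¹ y`. -/
def Gam (ℓ : ℕ) : Type := rootsOfUnity ℓ ℂ

namespace Gam

variable {ℓ : ℕ}

instance : CommGroup (Gam ℓ) := inferInstanceAs (CommGroup (rootsOfUnity ℓ ℂ))

instance [NeZero ℓ] : Fintype (Gam ℓ) := 
  haveI : Finite (Gam ℓ) := inferInstanceAs (Finite (rootsOfUnity ℓ ℂ))
  Fintype.ofFinite (Gam ℓ)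

/-- The underlying complex number (a unit). -/
def val : Gam ℓ →* ℂˣ := (rootsOfUnity ℓ ℂ).subtype

/-- The generator `α` of `Γ` given by a primitive `ℓ`-th root of unity `ε`. -/
def gen [NeZero ℓ] {ε : ℂ} (hε : IsPrimitiveRoot ε ℓ) : Gam ℓ := hε.toRootsOfUnity

lemma val_gen [NeZero ℓ] {ε : ℂ} (hε : IsPrimitiveRoot ε ℓ) : ((gen hε).val : ℂ) = ε := rfl

instance : MulSemiringAction (Gam ℓ) DReg where
  smul γ E := DReg.rot γ.val E
  one_smul E := by
    change DReg.rot (val 1) E = E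
    rw [map_one, DReg.rot_one]; rfl
  mul_smul γ γ' E := by
    change DReg.rot (val (γ * γ')) E = DReg.rot γ.val (DReg.rot γ'.val E)
    rw [map_mul, DReg.rot_mul]; rfl
  smul_zero γ := map_zero (DReg.rot γ.val)
  smul_add γ := map_add (DReg.rot γ.val)
  smul_one γ := map_one (DReg.rot γ.val)
  smul_mul γ := map_mul (DReg.rot γ.val)

lemma smul_DReg_def (γ : Gam ℓ) (E : DReg) : γ • E = DReg.rot γ.val E := rfl

instance : SMulCommClass (Gam ℓ) ℂ DReg where
  smul_comm γ z E := map_smul (DReg.rot γ.val) z E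

end Gam

/-! ### The rational Cherednik algebra of rank one -/

/-- The basis `x`, `y` of the two-dimensional space `L`. -/
inductive XY
  | x
  | y

/-- The tensor algebra `T L`, the free algebra on `x` and `y`. -/
abbrev TL : Type := FreeAlgebra ℂ XY

namespace TL

/-- The automorphism of `T L` with `x ↦ z x` and `y ↦ z⁻¹ y`. -/
def rot (z : ℂˣ) : TL →ₐ[ℂ] TL :=
  FreeAlgebra.lift ℂ (fun g => match g with
    | XY.x => (z : ℂ) • FreeAlgebra.ι ℂ XY.x
    | XY.y => ((z⁻¹ : ℂˣ) : ℂ) • FreeAlgebra.ι ℂ XY.y)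

lemma rot_one : rot 1 = AlgHom.id ℂ TL := by
  apply FreeAlgebra.hom_ext
  funext t
  cases t <;> simp [rot]

lemma rot_mul (z w : ℂˣ) : rot (z * w) = (rot z).comp (rot w) := by
  apply FreeAlgebra.hom_ext
  funext t
  cases t <;> simp [rot, smul_smul, mul_comm]

end TL

variable {ℓ : ℕ}

instance Gam.actionTL : MulSemiringAction (Gam ℓ) TL where
  smul γ E := TL.rot γ.val E
  one_smul E := by
    change TL.rot (Gam.val 1) E = E
    rw [map_one, TL.rot_one]; rfl
  mul_smul γ γ' E := by
    change TL.rot (Gam.val (γ * γ')) E = TL.rot γ.val (TL.rot γ'.val E)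
    rw [map_mul, TL.rot_mul]; rfl
  smul_zero γ := map_zero (TL.rot γ.val)
  smul_add γ := map_add (TL.rot γ.val)
  smul_one γ := map_one (TL.rot γ.val)
  smul_mul γ := map_mul (TL.rot γ.val)

instance Gam.smulCommTL : SMulCommClass (Gam ℓ) ℂ TL where
  smul_comm γ z E := map_smul (TL.rot γ.val) z E

/-- The smash product `Γ ⋉ A` of `Γ` with an algebra `A` on which it acts: the free left `A`-module
on `Γ` with `γ a = γ(a) γ`. -/
def Smash (A : Type) (ℓ : ℕ) [Ring A] [MulSemiringAction (Gam ℓ) A] : Type :=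
  SkewMonoidAlgebra A (Gam ℓ)

namespace Smash

variable {A : Type} [Ring A] [MulSemiringAction (Gam ℓ) A]

instance : Ring (Smash A ℓ) := inferInstanceAs (Ring (SkewMonoidAlgebra A (Gam ℓ)))

variable [Algebra ℂ A] [SMulCommClass (Gam ℓ) ℂ A]

instance : Algebra ℂ (Smash A ℓ) := inferInstanceAs (Algebra ℂ (SkewMonoidAlgebra A (Gam ℓ)))

/-- The inclusion of `A` in `Γ ⋉ A`. -/
def base : A →ₐ[ℂ] Smash A ℓ where
  __ := (SkewMonoidAlgebra.singleOneRingHom : A →+* SkewMonoidAlgebra A (Gam ℓ))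
  commutes' _ := rfl

/-- The inclusion of `Γ` in `Γ ⋉ A`. -/
def grp : Gam ℓ →* Smash A ℓ := SkewMonoidAlgebra.of A (Gam ℓ)

/-- The coefficient of `γ` in an element `∑ a_γ γ` of `Γ ⋉ A`. -/
def coeff (γ : Gam ℓ) : Smash A ℓ →ₗ[ℂ] A where
  toFun u := SkewMonoidAlgebra.coeff u γ
  map_add' u v := DFunLike.congr_fun (SkewMonoidAlgebra.coeff_add (k := A) (G := Gam ℓ) u v) γ
  map_smul' z u := DFunLike.congr_fun (SkewMonoidAlgebra.coeff_smul (k := A) (G := Gam ℓ) z u) γ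

lemma ext_coeff {u v : Smash A ℓ} (h : ∀ γ, coeff γ u = coeff γ v) : u = v :=
  SkewMonoidAlgebra.ext h

lemma grp_mul_base (γ : Gam ℓ) (a : A) :
    (grp γ * base a : Smash A ℓ) = base (γ • a) * grp γ := by
  have h : SkewMonoidAlgebra.of A (Gam ℓ) γ * SkewMonoidAlgebra.single 1 a =
      SkewMonoidAlgebra.single 1 (γ • a) * SkewMonoidAlgebra.of A (Gam ℓ) γ := by
    rw [SkewMonoidAlgebra.of_apply, SkewMonoidAlgebra.single_mul_single,
      SkewMonoidAlgebra.single_mul_single]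
    simp
  exact h

lemma coeff_mul_grp (u : Smash A ℓ) (γ γ' : Gam ℓ) :
    coeff γ (u * grp γ') = coeff (γ * γ'⁻¹) u := by
  have h : ∀ v : SkewMonoidAlgebra A (Gam ℓ),
      (v * SkewMonoidAlgebra.of A (Gam ℓ) γ').coeff γ = v.coeff (γ * γ'⁻¹) := fun v => by
    rw [SkewMonoidAlgebra.of_apply, SkewMonoidAlgebra.coeff_mul_single, smul_one, mul_one]
  exact h u

lemma coeff_grp_mul (u : Smash A ℓ) (γ γ' : Gam ℓ) :
    coeff γ (grp γ' * u) = γ' • coeff (γ'⁻¹ * γ) u := by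
  have h : ∀ v : SkewMonoidAlgebra A (Gam ℓ),
      (SkewMonoidAlgebra.of A (Gam ℓ) γ' * v).coeff γ = γ' • v.coeff (γ'⁻¹ * γ) := fun v => by
    rw [SkewMonoidAlgebra.of_apply, SkewMonoidAlgebra.coeff_single_mul, one_mul]
  exact h u

lemma coeff_base_mul (u : Smash A ℓ) (γ : Gam ℓ) (a : A) :
    coeff γ (base a * u) = a * coeff γ u :=
  SkewMonoidAlgebra.coeff_single_one_mul u a γ

lemma coeff_grp [DecidableEq (Gam ℓ)] (γ γ' : Gam ℓ) :
    coeff γ (grp γ' : Smash A ℓ) = if γ' = γ then 1 else 0 :=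
  by
    have h : (SkewMonoidAlgebra.of A (Gam ℓ) γ').coeff γ = if γ' = γ then 1 else 0 := by
      rw [SkewMonoidAlgebra.of_apply, SkewMonoidAlgebra.coeff_single_apply]
    exact h

/-- An algebra homomorphism out of `Γ ⋉ A` is given by compatible homomorphisms out of `A` and
`Γ`. -/
def lift {B : Type*} [Ring B] [Algebra ℂ B] (f : A →ₐ[ℂ] B) (g : Gam ℓ →* B)
    (h : ∀ a γ, f (γ • a) * g γ = g γ * f a) : Smash A ℓ →ₐ[ℂ] B :=
  SkewMonoidAlgebra.liftNCAlgHom f g (h _ _)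

lemma lift_base {B : Type*} [Ring B] [Algebra ℂ B] (f : A →ₐ[ℂ] B) (g : Gam ℓ →* B)
    (h : ∀ a γ, f (γ • a) * g γ = g γ * f a) (a : A) : lift f g h (base a) = f a := by
  change SkewMonoidAlgebra.liftNC _ _ (SkewMonoidAlgebra.single _ _) = _
  rw [SkewMonoidAlgebra.liftNC_single]
  simp

lemma lift_grp {B : Type*} [Ring B] [Algebra ℂ B] (f : A →ₐ[ℂ] B) (g : Gam ℓ →* B)
    (h : ∀ a γ, f (γ • a) * g γ = g γ * f a) (γ : Gam ℓ) : lift f g h (grp γ) = g γ := by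
  change SkewMonoidAlgebra.liftNC _ _ (SkewMonoidAlgebra.single _ _) = _
  rw [SkewMonoidAlgebra.liftNC_single]
  simp

variable (A) in
/-- The idempotent `e = |Γ|⁻¹ ∑ γ`. -/
def idem [NeZero ℓ] : Smash A ℓ := (ℓ : ℂ)⁻¹ • ∑ γ : Gam ℓ, grp γ

lemma grp_mul_idem [NeZero ℓ] (γ : Gam ℓ) : grp γ * (idem A : Smash A ℓ) = idem A := by
  rw [idem, mul_smul_comm, Finset.mul_sum]
  congr 1
  simp only [← map_mul]
  exact Fintype.sum_equiv (Equiv.mulLeft γ) _ _ (fun _ => rfl)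

lemma idem_mul_grp [NeZero ℓ] (γ : Gam ℓ) : (idem A : Smash A ℓ) * grp γ = idem A := by
  rw [idem, smul_mul_assoc, Finset.sum_mul]
  congr 1
  simp only [← map_mul]
  exact Fintype.sum_equiv (Equiv.mulRight γ) _ _ (fun _ => rfl)

lemma coeff_idem [NeZero ℓ] (γ : Gam ℓ) : coeff γ (idem A : Smash A ℓ) = (ℓ : ℂ)⁻¹ • 1 := by
  classical
  rw [idem, map_smul, map_sum]
  simp only [coeff_grp]
  rw [Finset.sum_ite_eq' Finset.univ γ, if_pos (Finset.mem_univ γ)]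

end Smash

/-- The defining relation `[y, x] = 1 + ∑_{m=1}^{ℓ-1} c_m α^m` of the rational Cherednik algebra.
The parameter `c_m`, `1 ≤ m ≤ ℓ - 1`, is `c ⟨m - 1, _⟩`. -/
inductive ChRel [NeZero ℓ] {ε : ℂ} (hε : IsPrimitiveRoot ε ℓ) (c : Fin (ℓ - 1) → ℂ) :
    Smash TL ℓ → Smash TL ℓ → Prop
  | comm : ChRel hε c
      (Smash.base (FreeAlgebra.ι ℂ XY.y * FreeAlgebra.ι ℂ XY.x
        - FreeAlgebra.ι ℂ XY.x * FreeAlgebra.ι ℂ XY.y))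
      (1 + ∑ m : Fin (ℓ - 1), c m • Smash.grp (Gam.gen hε ^ ((m : ℕ) + 1)))

/-- The rational Cherednik algebra `H_1(c)`. -/
abbrev H [NeZero ℓ] {ε : ℂ} (hε : IsPrimitiveRoot ε ℓ) (c : Fin (ℓ - 1) → ℂ) : Type :=
  RingQuot (ChRel hε c)

/-- The idempotent `e` in `H_1(c)`. -/
def idemH [NeZero ℓ] {ε : ℂ} (hε : IsPrimitiveRoot ε ℓ) (c : Fin (ℓ - 1) → ℂ) : H hε c :=
  RingQuot.mkAlgHom ℂ (ChRel hε c) (Smash.idem TL)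

/-- The underlying set of the spherical subalgebra `e H_1(c) e`. -/
def spherical [NeZero ℓ] {ε : ℂ} (hε : IsPrimitiveRoot ε ℓ) (c : Fin (ℓ - 1) → ℂ) :
    Set (H hε c) :=
  Set.range fun h : H hε c => idemH hε c * h * idemH hε c

/-! ### The Dunkl embedding -/

/-- The Dunkl operator
`∂ + ∑_{m=1}^{ℓ-1} c_m / ((ε^m - 1) x) (α^m - 1)` in `Γ ⋉ D(𝔱^reg)`. -/
def dunkl [NeZero ℓ] {ε : ℂ} (hε : IsPrimitiveRoot ε ℓ) (c : Fin (ℓ - 1) → ℂ) : Smash DReg ℓ :=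
  Smash.base DReg.d + ∑ m : Fin (ℓ - 1), (c m / (ε ^ ((m : ℕ) + 1) - 1)) •
    (Smash.base DReg.xinv * (Smash.grp (Gam.gen hε ^ ((m : ℕ) + 1)) - 1))

/-- The homomorphism `T L → Γ ⋉ D(𝔱^reg)` with `x ↦ x` and `y` going to the Dunkl operator. -/
def thetaTL [NeZero ℓ] {ε : ℂ} (hε : IsPrimitiveRoot ε ℓ) (c : Fin (ℓ - 1) → ℂ) :
    TL →ₐ[ℂ] Smash DReg ℓ :=
  FreeAlgebra.lift ℂ (fun g => match g with
    | XY.x => Smash.base DReg.x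
    | XY.y => dunkl hε c)

lemma grp_mul_dunkl [NeZero ℓ] {ε : ℂ} (hε : IsPrimitiveRoot ε ℓ) (c : Fin (ℓ - 1) → ℂ)
    (γ : Gam ℓ) :
    Smash.grp γ * dunkl hε c = (((γ.val)⁻¹ : ℂˣ) : ℂ) • dunkl hε c * Smash.grp γ := by
  have hd : γ • DReg.d = (((γ.val)⁻¹ : ℂˣ) : ℂ) • DReg.d := by
    simp [Gam.smul_DReg_def, DReg.rot]
  have hx : γ • DReg.xinv = (((γ.val)⁻¹ : ℂˣ) : ℂ) • DReg.xinv := by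
    simp [Gam.smul_DReg_def, DReg.rot]
  have hg : ∀ γ' : Gam ℓ, (Smash.grp γ : Smash DReg ℓ) * (Smash.grp γ' - 1)
      = (Smash.grp γ' - 1) * Smash.grp γ := by
    intro γ'
    rw [mul_sub, sub_mul, ← map_mul, ← map_mul, mul_comm γ, mul_one, one_mul]
  rw [dunkl, mul_add, Smash.grp_mul_base, hd, map_smul, smul_add, add_mul, Finset.mul_sum,
    Finset.smul_sum, Finset.sum_mul]
  congr 1
  apply Finset.sum_congr rfl
  intro m _
  rw [mul_smul_comm, ← mul_assoc, Smash.grp_mul_base, hx, map_smul, mul_assoc, hg,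
    smul_mul_assoc, ← mul_assoc, smul_comm, smul_mul_assoc, smul_mul_assoc]

/-- The homomorphism `Γ ⋉ T L → Γ ⋉ D(𝔱^reg)` with `x ↦ x`, `γ ↦ γ` for `γ ∈ Γ`, and `y` going
to the Dunkl operator. -/
def thetaSmash [NeZero ℓ] {ε : ℂ} (hε : IsPrimitiveRoot ε ℓ) (c : Fin (ℓ - 1) → ℂ) :
    Smash TL ℓ →ₐ[ℂ] Smash DReg ℓ :=
  Smash.lift (thetaTL hε c) Smash.grp (by
    intro t γ
    change thetaTL hε c (TL.rot γ.val t) * _ = _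
    induction t using FreeAlgebra.induction with
    | grade0 r => simp only [AlgHom.commutes, Algebra.commutes]
    | grade1 g =>
      cases g
      · have hx : γ • DReg.x = ((γ.val : ℂˣ) : ℂ) • DReg.x := by
          simp [Gam.smul_DReg_def, DReg.rot]
        have := Smash.grp_mul_base γ DReg.x
        rw [hx, map_smul] at this
        simp only [thetaTL, TL.rot, FreeAlgebra.lift_ι_apply, map_smul]
        exact this.symm
      · have := grp_mul_dunkl hε c γ
        simp only [thetaTL, TL.rot, FreeAlgebra.lift_ι_apply, map_smul]
        exact this.symm
    | mul a b ha hb =>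
      rw [map_mul, map_mul, mul_assoc, hb, ← mul_assoc, ha, map_mul, mul_assoc]
    | add a b ha hb => rw [map_add, map_add, add_mul, ha, hb, map_add, mul_add])

lemma dunkl_comm [NeZero ℓ] {ε : ℂ} (hε : IsPrimitiveRoot ε ℓ) (c : Fin (ℓ - 1) → ℂ) :
    dunkl hε c * Smash.base DReg.x - Smash.base DReg.x * dunkl hε c
      = 1 + ∑ m : Fin (ℓ - 1), c m • Smash.grp (Gam.gen hε ^ ((m : ℕ) + 1)) := by
  have hm : ∀ m : Fin (ℓ - 1), ε ^ ((m : ℕ) + 1) - 1 ≠ 0 := by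
    intro m h
    have h1 := (hε.pow_eq_one_iff_dvd _).1 (sub_eq_zero.1 h)
    have h2 := Nat.le_of_dvd (Nat.succ_pos _) h1
    have := m.2
    omega
  have key : ∀ m : Fin (ℓ - 1), (Smash.base DReg.xinv *
        (Smash.grp (Gam.gen hε ^ ((m : ℕ) + 1)) - 1)) * Smash.base DReg.x
      - Smash.base DReg.x * (Smash.base DReg.xinv *
        (Smash.grp (Gam.gen hε ^ ((m : ℕ) + 1)) - 1)) =
      (ε ^ ((m : ℕ) + 1) - 1) • (Smash.grp (Gam.gen hε ^ ((m : ℕ) + 1)) : Smash DReg ℓ) := by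
    intro m
    have h1 : (Gam.gen hε ^ ((m : ℕ) + 1)) • DReg.x = (ε ^ ((m : ℕ) + 1)) • DReg.x := by
      rw [Gam.smul_DReg_def, map_pow]
      simp [DReg.rot, Gam.val_gen]
    rw [mul_assoc, sub_mul, Smash.grp_mul_base, h1, ← mul_assoc, ← map_mul, DReg.x_mul_xinv,
      map_one, one_mul, one_mul, mul_sub, ← mul_assoc, ← map_mul, mul_smul_comm, ← map_mul,
      DReg.xinv_mul_x, map_smul, map_one, smul_mul_assoc, one_mul, sub_smul, one_smul]
    abel
  have h0 : (Smash.base DReg.d : Smash DReg ℓ) * Smash.base DReg.x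
      - Smash.base DReg.x * Smash.base DReg.d = 1 := by
    rw [← map_mul, ← map_mul, ← map_sub, DReg.d_mul_x, add_sub_cancel_left, map_one]
  rw [dunkl, add_mul, mul_add, add_sub_add_comm, h0, Finset.sum_mul, Finset.mul_sum,
    ← Finset.sum_sub_distrib]
  congr 1
  apply Finset.sum_congr rfl
  intro m _
  rw [smul_mul_assoc, mul_smul_comm, ← smul_sub, key, smul_smul, div_mul_cancel₀ _ (hm m)]

/-- The Dunkl embedding `Θ_c : H_1(c) → Γ ⋉ D(𝔱^reg)`. -/
def theta [NeZero ℓ] {ε : ℂ} (hε : IsPrimitiveRoot ε ℓ) (c : Fin (ℓ - 1) → ℂ) :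
    H hε c →ₐ[ℂ] Smash DReg ℓ :=
  RingQuot.liftAlgHom ℂ ⟨thetaSmash hε c, by
    intro u v h
    cases h
    rw [thetaSmash, Smash.lift_base, map_add, map_one, map_sum, map_sub, map_mul, map_mul]
    simp only [map_smul, Smash.lift_grp]
    rw [← dunkl_comm]
    simp [thetaTL]⟩

/-- The map `Θ_c^sph` from `e H_1(c) e` to `D(𝔱^reg)`: the operator `E` with `Θ_c(u) = E e`.
Since `e = |Γ|⁻¹ ∑ γ`, it is `|Γ|` times the coefficient of `1 ∈ Γ` in `Θ_c(u)`; see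
`theta_eq_thetaSph_mul_idem`. -/
def thetaSph [NeZero ℓ] {ε : ℂ} (hε : IsPrimitiveRoot ε ℓ) (c : Fin (ℓ - 1) → ℂ)
    (u : H hε c) : DReg :=
  (ℓ : ℂ) • Smash.coeff 1 (theta hε c u)

lemma theta_idem [NeZero ℓ] {ε : ℂ} (hε : IsPrimitiveRoot ε ℓ) (c : Fin (ℓ - 1) → ℂ) :
    theta hε c (idemH hε c) = Smash.idem DReg := by
  rw [theta, idemH, RingQuot.liftAlgHom_mkAlgHom_apply, Smash.idem, map_smul, map_sum]
  simp only [thetaSmash, Smash.lift_grp]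
  rfl

lemma theta_spherical [NeZero ℓ] {ε : ℂ} (hε : IsPrimitiveRoot ε ℓ) (c : Fin (ℓ - 1) → ℂ)
    {u : H hε c} (hu : u ∈ spherical hε c) :
    (∀ γ : Gam ℓ, Smash.coeff γ (theta hε c u) = Smash.coeff 1 (theta hε c u)) ∧
      ∀ γ : Gam ℓ, γ • Smash.coeff 1 (theta hε c u) = Smash.coeff 1 (theta hε c u) := by
  obtain ⟨h, rfl⟩ := hu
  simp only [map_mul, theta_idem]
  set w : Smash DReg ℓ := Smash.idem DReg * theta hε c h * Smash.idem DReg with hw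
  have h1 : ∀ γ, w * Smash.grp γ = w := by
    intro γ
    rw [hw, mul_assoc, Smash.idem_mul_grp]
  have h2 : ∀ γ, Smash.grp γ * w = w := by
    intro γ
    rw [hw, ← mul_assoc, ← mul_assoc, Smash.grp_mul_idem]
  have h3 : ∀ γ : Gam ℓ, Smash.coeff γ w = Smash.coeff 1 w := by
    intro γ
    conv_lhs => rw [← h1 γ]
    rw [Smash.coeff_mul_grp, mul_inv_cancel]
  refine ⟨h3, fun γ => ?_⟩
  have := congrArg (fun v => Smash.coeff γ v) (h2 γ)
  simp only [Smash.coeff_grp_mul, inv_mul_cancel] at this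
  rw [this, h3]

/-- The defining property of `Θ_c^sph`. -/
lemma theta_eq_thetaSph_mul_idem [NeZero ℓ] {ε : ℂ} (hε : IsPrimitiveRoot ε ℓ)
    (c : Fin (ℓ - 1) → ℂ) {u : H hε c} (hu : u ∈ spherical hε c) :
    theta hε c u = Smash.base (thetaSph hε c u) * Smash.idem DReg := by
  apply Smash.ext_coeff
  intro γ
  rw [Smash.coeff_base_mul, (theta_spherical hε c hu).1 γ, thetaSph, Smash.coeff_idem,
    smul_mul_smul_comm, mul_inv_cancel₀ (Nat.cast_ne_zero.2 (NeZero.ne ℓ)), one_smul, mul_one]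

/-- The operators in the image of `Θ_c^sph` are `Γ`-invariant. -/
lemma smul_thetaSph [NeZero ℓ] {ε : ℂ} (hε : IsPrimitiveRoot ε ℓ) (c : Fin (ℓ - 1) → ℂ)
    {u : H hε c} (hu : u ∈ spherical hε c) (γ : Gam ℓ) :
    γ • thetaSph hε c u = thetaSph hε c u := by
  rw [thetaSph, smul_comm, (theta_spherical hε c hu).2]

/-! ### Representations of the cyclic quiver and equivariant functions

The space of representations of dimension vector `(1, …, 1)` is `ℂ^ℓ` with the coordinates
`a i = A_{i,i+1}`, `i : Fin ℓ` (indices are read modulo `ℓ`). The group `G = (ℂ^×)^ℓ` acts by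
`a i ↦ g i * a i * (g (i + 1))⁻¹`. -/

/-- Rational functions on the space of representations. -/
abbrev RatA (ℓ : ℕ) : Type := FractionRing (MvPolynomial (Fin ℓ) ℂ)

/-- Rational functions on `𝔱 = ℂ`. -/
abbrev RatX : Type := FractionRing ℂ[X]

/-- The coordinate `a i` as a rational function. -/
def coordA (i : Fin ℓ) : RatA ℓ := algebraMap (MvPolynomial (Fin ℓ) ℂ) _ (MvPolynomial.X i)

/-- The coordinate `x` as a rational function. -/
def coordX : RatX := algebraMap ℂ[X] _ Polynomial.X

lemma coordA_ne_zero (i : Fin ℓ) : coordA i ≠ 0 := by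
  simp [coordA]

lemma coordX_ne_zero : coordX ≠ 0 := by
  simp [coordX]

/-- The operator `∂ i + r i / a i` on rational functions. -/
def twistedPartial (r : Fin ℓ → ℂ) (i : Fin ℓ) : Module.End ℂ (RatA ℓ) :=
  (fracDeriv (MvPolynomial.pderiv (R := ℂ) i) : RatA ℓ →ₗ[ℂ] RatA ℓ)
    + r i • LinearMap.mulLeft ℂ (coordA i)⁻¹

/-- The operator `d/dx + s / x` on rational functions. -/
def twistedDeriv (s : ℂ) : Module.End ℂ RatX :=
  (fracDeriv (Polynomial.derivative' (R := ℂ)) : RatX →ₗ[ℂ] RatX)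
    + s • LinearMap.mulLeft ℂ coordX⁻¹

lemma fracDeriv_coordA (i j : Fin ℓ) :
    fracDeriv (MvPolynomial.pderiv (R := ℂ) i) (coordA j) = if i = j then 1 else 0 := by
  rw [coordA, fracDeriv_algebraMap, MvPolynomial.pderiv_X, Pi.single_apply]
  split_ifs with h1 h2 h2 <;> simp_all

lemma twistedPartial_coord (r : Fin ℓ → ℂ) (i j : Fin ℓ) :
    twistedPartial r i * LinearMap.mulLeft ℂ (coordA j)
      = LinearMap.mulLeft ℂ (coordA j) * twistedPartial r i + if i = j then 1 else 0 := by
  ext f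
  have h : ((if i = j then 1 else 0 : Module.End ℂ (RatA ℓ)) f) = (if i = j then 1 else 0) * f := by
    split_ifs <;> simp
  simp only [twistedPartial, Module.End.mul_apply, LinearMap.add_apply, LinearMap.smul_apply,
    LinearMap.mulLeft_apply, Derivation.coeFn_coe, Derivation.leibniz, fracDeriv_coordA,
    smul_eq_mul, h]
  rw [mul_left_comm (coordA i)⁻¹, ← mul_smul_comm]
  ring

lemma twistedPartial_comm (r : Fin ℓ → ℂ) (i j : Fin ℓ) :
    twistedPartial r i * twistedPartial r j = twistedPartial r j * twistedPartial r i := by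
  by_cases hij : i = j
  · rw [hij]
  have hc : ∀ f : RatA ℓ, fracDeriv (MvPolynomial.pderiv (R := ℂ) i)
      (fracDeriv (MvPolynomial.pderiv (R := ℂ) j) f) =
      fracDeriv (MvPolynomial.pderiv (R := ℂ) j) (fracDeriv (MvPolynomial.pderiv (R := ℂ) i) f) :=
    fun f => fracDeriv_comm _ _ (fun a => by
      have h0 : ⁅MvPolynomial.pderiv (R := ℂ) i, MvPolynomial.pderiv (R := ℂ) j⁆ = 0 := by
        apply MvPolynomial.derivation_ext
        intro k
        simp [Derivation.commutator_apply, MvPolynomial.pderiv_X, Pi.single_apply, apply_ite]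
      have := DFunLike.congr_fun h0 a
      simpa [Derivation.commutator_apply, sub_eq_zero] using this) f
  have h1 : ∀ i j : Fin ℓ, i ≠ j →
      fracDeriv (MvPolynomial.pderiv (R := ℂ) i) (coordA j)⁻¹ = 0 := by
    intro i j hij
    rw [Derivation.leibniz_inv, fracDeriv_coordA, if_neg hij, smul_zero]
  ext f
  simp only [twistedPartial, Module.End.mul_apply, LinearMap.add_apply, LinearMap.smul_apply,
    LinearMap.mulLeft_apply, Derivation.coeFn_coe, map_add, Derivation.leibniz,
    smul_eq_mul, h1 i j hij, h1 j i (Ne.symm hij), hc, Algebra.smul_def (A := RatA ℓ), Derivation.map_algebraMap,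
    mul_zero, add_zero]
  ring

lemma twistedDeriv_coord (s : ℂ) :
    twistedDeriv s * LinearMap.mulLeft ℂ coordX
      = LinearMap.mulLeft ℂ coordX * twistedDeriv s + 1 := by
  ext f
  have h : fracDeriv (Polynomial.derivative' (R := ℂ)) coordX = 1 := by
    rw [coordX, fracDeriv_algebraMap]
    simp [Polynomial.derivative']
  simp only [twistedDeriv, Module.End.mul_apply, LinearMap.add_apply, LinearMap.smul_apply,
    LinearMap.mulLeft_apply, Derivation.coeFn_coe, Derivation.leibniz, h,
    smul_eq_mul, Module.End.one_apply]
  rw [mul_left_comm coordX⁻¹, ← mul_smul_comm]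
  ring

/-- The action of differential operators on multivalued functions `f ∏ (a i)^(r i)` with `f`
rational. Such a function is represented by `f`, and
`∂ i (f ∏ (a j)^(r j)) = (∂ i f + r i / a i * f) ∏ (a j)^(r j)`. -/
def actA (r : Fin ℓ → ℂ) : Weyl (Fin ℓ) →ₐ[ℂ] Module.End ℂ (RatA ℓ) :=
  RingQuot.liftAlgHom ℂ ⟨FreeAlgebra.lift ℂ (Sum.elim
    (fun i => LinearMap.mulLeft ℂ (coordA i)) (twistedPartial r)), by
      intro u v h
      cases h with
      | coord i j =>
        simp only [map_mul, FreeAlgebra.lift_ι_apply, Sum.elim_inl]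
        ext f
        simp only [Module.End.mul_apply, LinearMap.mulLeft_apply]
        ring
      | deriv i j =>
        simp only [map_mul, FreeAlgebra.lift_ι_apply, Sum.elim_inr]
        exact twistedPartial_comm r i j
      | mixed i j =>
        simp only [map_mul, map_add, FreeAlgebra.lift_ι_apply, Sum.elim_inr, Sum.elim_inl,
          twistedPartial_coord]
        split_ifs <;> simp⟩

/-- The action of `D(𝔱^reg)` on multivalued functions `f x^s` with `f` rational. Such a function is
represented by `f`, and `d/dx (f x^s) = (df/dx + s / x * f) x^s`. -/
def actX (s : ℂ) : DReg →ₐ[ℂ] Module.End ℂ RatX :=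
  DReg.lift (LinearMap.mulLeft ℂ coordX) (LinearMap.mulLeft ℂ coordX⁻¹) (twistedDeriv s)
    (by ext f; simp [mul_inv_cancel_left₀ coordX_ne_zero])
    (by ext f; simp [inv_mul_cancel_left₀ coordX_ne_zero])
    (twistedDeriv_coord s)

/-- Restriction of polynomials to the slice `{(x, …, x)}`. -/
def resPoly : MvPolynomial (Fin ℓ) ℂ →ₐ[ℂ] ℂ[X] := MvPolynomial.aeval (fun _ => Polynomial.X)

/-- Restriction of a rational function `p / q` in lowest terms to the slice. It is meaningful when
`q` does not vanish identically on the slice; otherwise it has the value `0`. -/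
def resRat (f : RatA ℓ) : RatX :=
  algebraMap ℂ[X] RatX (resPoly (IsFractionRing.num (MvPolynomial (Fin ℓ) ℂ) f)) /
    algebraMap ℂ[X] RatX (resPoly (IsFractionRing.den (MvPolynomial (Fin ℓ) ℂ) f :
      MvPolynomial (Fin ℓ) ℂ))

/-! ### The character, the equivariant functions and the radial part -/

section Radial

variable [NeZero ℓ]

/-- The coefficients of the character: `C_0 = (1 - ℓ + ∑ c_m) / ℓ` and
`C_i = (1 + ∑ ε^(m i) c_m) / ℓ` for `1 ≤ i ≤ ℓ - 1`, where `m` runs from `1` to `ℓ - 1`. -/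
def coefC (ε : ℂ) (c : Fin (ℓ - 1) → ℂ) (i : Fin ℓ) : ℂ :=
  if i = 0 then (1 - ℓ) / ℓ + 1 / ℓ * ∑ m : Fin (ℓ - 1), c m
  else 1 / ℓ + 1 / ℓ * ∑ m : Fin (ℓ - 1), ε ^ (((m : ℕ) + 1) * (i : ℕ)) * c m

/-- The infinitesimal character `χ_c` of the torus, `ξ ↦ ∑ C_i ξ_i`. It vanishes on the diagonal
(see `chi_const`), so it is a character of the Lie algebra `ℂ^ℓ / ℂ`. -/
def chi (ε : ℂ) (c : Fin (ℓ - 1) → ℂ) (ξ : Fin ℓ → ℂ) : ℂ := ∑ i, coefC ε c i * ξ i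

/-- The constant `σ = - (∑ s C_s) / ℓ`. -/
def sigma (ε : ℂ) (c : Fin (ℓ - 1) → ℂ) : ℂ := -(∑ s : Fin ℓ, (s : ℕ) * coefC ε c s) / ℓ

/-- The exponents `r_i = -σ + ∑_{j ≤ i} C_j`. -/
def expo (ε : ℂ) (c : Fin (ℓ - 1) → ℂ) (i : Fin ℓ) : ℂ :=
  -sigma ε c + ∑ j ∈ Finset.Iic i, coefC ε c j

/-- The vector field `∑ (ξ i - ξ (i + 1)) a i ∂ i` by which `ξ` in the Lie algebra of the torus
acts: `L_ξ f (a) = d/dt f (exp (t ξ) · a)` at `t = 0`. -/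
def lieOp (ξ : Fin ℓ → ℂ) : Weyl (Fin ℓ) :=
  ∑ i, (ξ i - ξ (i + 1)) • (Weyl.a i * Weyl.d i)

lemma lieOp_const (z : ℂ) : lieOp (ℓ := ℓ) (fun _ => z) = 0 := by
  simp [lieOp]

/-- The algebra of invariant differential operators on the space of representations. -/
def invariantOps (ℓ : ℕ) [NeZero ℓ] : Subalgebra ℂ (Weyl (Fin ℓ)) :=
  Subalgebra.centralizer ℂ (Set.range lieOp)

/-- The space of functions `f = f' ∏ (a i)^(r i)`, `f'` rational, with `L_ξ f = χ_c(ξ) f` for all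
`ξ`; the function `f` is represented by `f'`. -/
def Fun (ε : ℂ) (c : Fin (ℓ - 1) → ℂ) : Set (RatA ℓ) :=
  {f | ∀ ξ : Fin ℓ → ℂ, actA (expo ε c) (lieOp ξ) f = chi ε c ξ • f}

/-- `E` is the radial part of `D`: `Res (D f) = E (Res f)` for all equivariant functions `f`.
Here `Res f` is the restriction of `f` to the points `(x, …, x)`, that is
`f'(x, …, x) x^(∑ r_i)` for `f = f' ∏ (a i)^(r i)`. -/
def IsRadialPart (ε : ℂ) (c : Fin (ℓ - 1) → ℂ) (D : Weyl (Fin ℓ)) (E : DReg) : Prop :=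
  ∀ f ∈ Fun ε c, resRat (actA (expo ε c) D f) = actX (∑ i, expo ε c i) E (resRat f)

/-- The radial part of `D`. -/
def radialPart (ε : ℂ) (c : Fin (ℓ - 1) → ℂ) (D : Weyl (Fin ℓ)) : DReg :=
  Classical.epsilon (IsRadialPart ε c D)

/-- The twisted radial part `x^(-ℓσ) ∘ R_c(D) ∘ x^(ℓσ)`. -/
def twistedRadialPart (ε : ℂ) (c : Fin (ℓ - 1) → ℂ) (D : Weyl (Fin ℓ)) : DReg :=
  DReg.conjPow (ℓ * sigma ε c) (radialPart ε c D)

lemma sum_coefC {ε : ℂ} (hε : IsPrimitiveRoot ε ℓ) (c : Fin (ℓ - 1) → ℂ) :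
    ∑ i, coefC ε c i = 0 := by
  have hℓ : (ℓ : ℂ) ≠ 0 := Nat.cast_ne_zero.2 (NeZero.ne ℓ)
  have h1 : ∀ i : Fin ℓ, coefC ε c i = (if i = 0 then -1 else 0) + (1 / ℓ +
      1 / ℓ * ∑ m : Fin (ℓ - 1), ε ^ (((m : ℕ) + 1) * (i : ℕ)) * c m) := by
    intro i
    unfold coefC
    split_ifs with h
    · subst h
      simp
      field_simp
      ring
    · simp
  have h2 : ∀ m : Fin (ℓ - 1), ∑ i : Fin ℓ, ε ^ (((m : ℕ) + 1) * (i : ℕ)) * c m = 0 := by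
    intro m
    have hne : ε ^ ((m : ℕ) + 1) ≠ 1 := by
      intro h
      have h3 := Nat.le_of_dvd (Nat.succ_pos _) ((hε.pow_eq_one_iff_dvd _).1 h)
      have := m.2
      omega
    rw [← Finset.sum_mul]
    simp only [pow_mul]
    rw [Fin.sum_univ_eq_sum_range (fun i => (ε ^ ((m : ℕ) + 1)) ^ i) ℓ, geom_sum_eq hne,
      ← pow_mul, mul_comm ((m : ℕ) + 1), pow_mul, hε.pow_eq_one, one_pow]
    simp
  simp only [h1, Finset.sum_add_distrib, ← Finset.mul_sum]
  rw [Finset.sum_comm]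
  simp [h2, hℓ]

lemma chi_const {ε : ℂ} (hε : IsPrimitiveRoot ε ℓ) (c : Fin (ℓ - 1) → ℂ) (z : ℂ) :
    chi ε c (fun _ => z) = 0 := by
  rw [chi, ← Finset.sum_mul, sum_coefC hε, zero_mul]

end Radial

end CyclicQuiver

end

/-! Both sides of the equality are computed explicitly. Each turns out to be the subalgebra
`sphericalImage` of `DReg` generated by `x^ℓ`, the Euler operator `x∂` and `x^(-ℓ) P(x∂)`, where
`P(X) = ∏_i (X + ℓ ∑_{j ≤ i} C_j)`.

Quiver side. A normally ordered monomial `a^α ∂^β` is a weight vector for the torus, and it is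
invariant when `α_i - β_i` does not depend on `i`. So the invariant operators are generated by `∏
a_i`, `∏ ∂_i` and the `a_i ∂_i` (`adjoin_invariantGens`). The exponents `r_i` are chosen so that `∏
a_i^(r_i)` has weight `χ_c`; equivariance of `f` then says that all `a_i ∂_i` agree on its rational
factor (`mem_Fun_iff`). Their sum is tangent to the slice and restricts to `x d/dx`, so each `a_i
∂_i` has radial part `x∂/ℓ + r_i`, while `∏ a_i` has radial part `x^ℓ`. Since `∏ a_i ∏ ∂_i = ∏ (a_i
∂_i)`, the operator `∏ ∂_i` has radial part `x^(-ℓ) ∏ (x∂/ℓ + r_i)`. Conjugation by `x^(ℓσ)` removes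
`-σ` from `r_i`, which leaves `ℓ^(-ℓ) x^(-ℓ) P(x∂)`. Radial parts are unique because an operator
that kills all `x^(ℓk)` is zero. Restriction is meaningful because the reduced denominator of an
equivariant function is a weight vector, hence nonzero on the slice (`isRegular_of_mem_Fun`).

Dunkl side. With `y` the Dunkl operator, `xy` is `x∂` plus a combination of group elements, and
these act on `y^k e` by scalars. Hence `x^a y^a e = ∏_{k < a} (x∂ + z_k - k) e`
(`dunklMonomial_diag`). For `a = ℓ` the factors are those of `P` in reverse order
(`dunklPolyAux_self`), so `y^ℓ e = x^(-ℓ) P(x∂) e`. The spherical algebra is spanned by the `e x^a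
y^b e`, which vanish unless `a ≡ b` mod `ℓ` and otherwise are products of `x^ℓ`, `y^ℓ` and some `x^k
y^k`. -/

noncomputable section

namespace CyclicQuiver

open scoped Polynomial

/-! ### Normal forms in `D(𝔱^reg)` -/

namespace DReg

/-- The Euler operator `x ∂`. -/
def euler : DReg := x * d

lemma euler_mul_x : euler * x = x * (euler + 1) := by
  rw [euler, mul_assoc, d_mul_x]

lemma euler_mul_x_pow (n : ℕ) : euler * x ^ n = x ^ n * (euler + (n : ℂ) • 1) := by
  induction n with
  | zero => simp
  | succ n ih =>
    rw [pow_succ, ← mul_assoc, ih, mul_assoc, add_mul, euler_mul_x, mul_assoc]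
    congr 1
    push_cast
    simp only [add_smul, mul_add, smul_mul_assoc, mul_smul_comm, one_smul, one_mul, mul_one]
    abel

lemma xinv_pow_mul_x_pow (n : ℕ) : xinv ^ n * x ^ n = 1 := by
  induction n with
  | zero => simp
  | succ n ih => rw [pow_succ, pow_succ', mul_assoc, ← mul_assoc xinv, xinv_mul_x, one_mul, ih]

/-- The operators `∑ x^j p_j(x ∂)`. -/
def polyPart : Submodule ℂ DReg :=
  Submodule.span ℂ (Set.range fun q : ℕ × ℂ[X] => x ^ q.1 * Polynomial.aeval euler q.2)

lemma mul_mem_polyPart {u : DReg}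
    (h : ∀ (j : ℕ) (p : ℂ[X]), u * (x ^ j * Polynomial.aeval euler p) ∈ polyPart) {E : DReg}
    (hE : E ∈ polyPart) : u * E ∈ polyPart := by
  have : polyPart ≤ polyPart.comap (LinearMap.mulLeft ℂ u) := by
    conv_lhs => rw [polyPart]
    rw [Submodule.span_le]
    rintro _ ⟨⟨j, p⟩, rfl⟩
    exact h j p
  exact this hE

lemma x_pow_mul_mem_polyPart (n : ℕ) {E : DReg} (hE : E ∈ polyPart) : x ^ n * E ∈ polyPart := by
  refine mul_mem_polyPart (fun j p => ?_) hE
  rw [← mul_assoc, ← pow_add]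
  exact Submodule.subset_span ⟨(n + j, p), rfl⟩

lemma euler_mul_mem_polyPart {E : DReg} (hE : E ∈ polyPart) : euler * E ∈ polyPart := by
  refine mul_mem_polyPart (fun j p => ?_) hE
  rw [← mul_assoc, euler_mul_x_pow, mul_assoc]
  refine Submodule.subset_span ⟨(j, (Polynomial.X + Polynomial.C (j : ℂ)) * p), ?_⟩
  simp only [map_mul, map_add, Polynomial.aeval_X, Polynomial.aeval_C,
    Algebra.algebraMap_eq_smul_one]

/-- Each letter of a word costs at most one power of `x`: `x^(N+1) x⁻¹ = x^N` and `x^(N+1) ∂ = (x∂ -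
N) x^N`. -/
lemma exists_x_pow_mul_mem_polyPart (E : DReg) : ∃ N : ℕ, x ^ N * E ∈ polyPart := by
  obtain ⟨w, rfl⟩ := RingQuot.mkAlgHom_surjective ℂ RegRel E
  -- The claim is strengthened to left multiplication by a word, so that it composes in the product
  -- case.
  suffices h : ∀ E, (∃ N : ℕ, x ^ N * E ∈ polyPart) →
      ∃ N : ℕ, x ^ N * (RingQuot.mkAlgHom ℂ RegRel w * E) ∈ polyPart by
    simpa using h 1 ⟨0, Submodule.subset_span ⟨(0, 1), by simp⟩⟩
  induction w using FreeAlgebra.induction with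
  | grade0 r =>
    rintro E ⟨N, hN⟩
    refine ⟨N, ?_⟩
    rw [AlgHom.commutes, ← Algebra.smul_def, mul_smul_comm]
    exact Submodule.smul_mem _ _ hN
  | grade1 g =>
    rintro E ⟨N, hN⟩
    cases g
    · change ∃ N : ℕ, x ^ N * (x * E) ∈ polyPart
      refine ⟨N, ?_⟩
      rw [← mul_assoc, ← pow_succ, pow_succ', mul_assoc]
      simpa using x_pow_mul_mem_polyPart 1 hN
    · change ∃ N : ℕ, x ^ N * (xinv * E) ∈ polyPart
      refine ⟨N + 1, ?_⟩
      rwa [pow_succ, mul_assoc, ← mul_assoc x, x_mul_xinv, one_mul]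
    · change ∃ N : ℕ, x ^ N * (d * E) ∈ polyPart
      refine ⟨N + 1, ?_⟩
      have h := euler_mul_x_pow N
      rw [mul_add, ← sub_eq_iff_eq_add, mul_smul_comm, mul_one] at h
      rw [pow_succ, mul_assoc, ← mul_assoc x, ← euler, ← mul_assoc, ← h, sub_mul, smul_mul_assoc,
        mul_assoc]
      exact Submodule.sub_mem _ (euler_mul_mem_polyPart hN) (Submodule.smul_mem _ _ hN)
  | mul a b ha hb =>
    intro E hE
    rw [map_mul, mul_assoc]
    exact ha _ (hb _ hE)
  | add a b ha hb =>
    intro E hE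
    obtain ⟨N, hN⟩ := ha E hE
    obtain ⟨M, hM⟩ := hb E hE
    refine ⟨N + M, ?_⟩
    rw [map_add, add_mul, mul_add]
    refine Submodule.add_mem _ ?_ ?_
    · rw [add_comm, pow_add, mul_assoc]
      exact x_pow_mul_mem_polyPart M hN
    · rw [pow_add, mul_assoc]
      exact x_pow_mul_mem_polyPart N hM

lemma exists_eq_sum_of_mem_polyPart {E : DReg} (hE : E ∈ polyPart) :
    ∃ P : ℕ →₀ ℂ[X], E = P.sum fun j p => x ^ j * Polynomial.aeval euler p := by
  induction hE using Submodule.span_induction with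
  | mem E h =>
    obtain ⟨⟨j, p⟩, rfl⟩ := h
    exact ⟨Finsupp.single j p, by simp⟩
  | zero => exact ⟨0, by simp⟩
  | add E F _ _ hE hF =>
    obtain ⟨P, rfl⟩ := hE
    obtain ⟨Q, rfl⟩ := hF
    exact ⟨P + Q, by rw [Finsupp.sum_add_index'] <;> simp [mul_add]⟩
  | smul z E _ hE =>
    obtain ⟨P, rfl⟩ := hE
    refine ⟨z • P, ?_⟩
    rw [Finsupp.sum_smul_index' (by simp), Finsupp.smul_sum]
    simp

end DReg

/-! ### Faithfulness of `D(𝔱^reg)` on the powers `x^(ℓk)` -/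

lemma fracDeriv_coordX : fracDeriv (Polynomial.derivative' (R := ℂ)) coordX = 1 := by
  rw [coordX, fracDeriv_algebraMap]
  simp [Polynomial.derivative']

lemma actX_x (s : ℂ) (f : RatX) : actX s DReg.x f = coordX * f := by simp [actX]

lemma actX_x_pow (s : ℂ) (n : ℕ) (f : RatX) : actX s (DReg.x ^ n) f = coordX ^ n * f := by
  induction n with
  | zero => simp
  | succ n ih => rw [pow_succ', map_mul, Module.End.mul_apply, ih, actX_x, pow_succ', mul_assoc]

lemma actX_euler (s : ℂ) (f : RatX) : actX s DReg.euler f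
    = coordX * fracDeriv (Polynomial.derivative' (R := ℂ)) f + s • f := by
  simp [actX, DReg.euler, twistedDeriv, mul_add, mul_inv_cancel_left₀ coordX_ne_zero]

/-- Here `coordX ^ n` stands for the function `x^(n+s)`, which explains the eigenvalue. -/
lemma actX_euler_coordX_pow (s : ℂ) (n : ℕ) :
    actX s DReg.euler (coordX ^ n) = ((n : ℂ) + s) • coordX ^ n := by
  rw [actX_euler, Derivation.leibniz_pow, fracDeriv_coordX, add_smul]
  congr 1
  cases n with
  | zero => simp
  | succ n => simp [pow_succ, Algebra.smul_def]; ring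

lemma actX_aeval_euler_coordX_pow (s : ℂ) (p : ℂ[X]) (n : ℕ) :
    actX s (Polynomial.aeval DReg.euler p) (coordX ^ n) = p.eval ((n : ℂ) + s) • coordX ^ n := by
  have := Module.End.aeval_apply_of_hasEigenvector (f := actX s DReg.euler) (μ := (n : ℂ) + s)
    (p := p) (x := coordX ^ n) ⟨Module.End.mem_eigenspace_iff.2 (actX_euler_coordX_pow s n),
      pow_ne_zero _ coordX_ne_zero⟩
  rwa [← Polynomial.aeval_algHom_apply]

/-- An operator that annihilates `x^(ℓ k + s)` for all `k : ℕ` is zero. -/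
lemma eq_zero_of_actX_coordX_pow {ℓ : ℕ} (hℓ : ℓ ≠ 0) (s : ℂ) {E : DReg}
    (h : ∀ k : ℕ, actX s E (coordX ^ (ℓ * k)) = 0) : E = 0 := by
  obtain ⟨N, hN⟩ := DReg.exists_x_pow_mul_mem_polyPart E
  obtain ⟨P, hP⟩ := DReg.exists_eq_sum_of_mem_polyPart hN
  have h1 : ∀ (k j : ℕ), (P j).eval (((ℓ * k : ℕ) : ℂ) + s) = 0 := by
    intro k j
    have h2 : actX s (DReg.x ^ N * E) (coordX ^ (ℓ * k)) = 0 := by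
      rw [map_mul, Module.End.mul_apply, h, map_zero]
    have h3 : algebraMap ℂ[X] RatX (∑ i ∈ P.support,
        Polynomial.monomial (i + ℓ * k) ((P i).eval (((ℓ * k : ℕ) : ℂ) + s))) = 0 := by
      rw [← h2, hP, Finsupp.sum, map_sum, map_sum, LinearMap.sum_apply]
      refine Finset.sum_congr rfl fun i _ => ?_
      rw [map_mul, Module.End.mul_apply, actX_aeval_euler_coordX_pow, map_smul, actX_x_pow,
        ← pow_add, ← Polynomial.smul_X_eq_monomial, coordX, ← map_pow]
      exact algebraMap.coe_smul (A := ℂ) (B := ℂ[X]) (C := RatX) _ _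
    -- The terms `x^j p_j(x∂)` send `x^(ℓk)` to multiples of distinct powers of `x`, so each `p_j`
    -- vanishes at `ℓk + s` separately.
    have h4 := congrArg (fun q => Polynomial.coeff q (j + ℓ * k))
      ((map_eq_zero_iff _ (IsFractionRing.injective ℂ[X] RatX)).1 h3)
    simp only [Polynomial.finsetSum_coeff, Polynomial.coeff_monomial, add_left_inj,
      Finset.sum_ite_eq', Polynomial.coeff_zero] at h4
    by_cases hj : j ∈ P.support
    · simpa [hj] using h4
    · simp [Finsupp.notMem_support_iff.1 hj]
  have h5 : P = 0 := by
    ext1 j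
    refine Polynomial.eq_zero_of_infinite_isRoot _ ?_
    refine (Set.infinite_range_of_injective (f := fun k : ℕ => ((ℓ * k : ℕ) : ℂ) + s) ?_).mono ?_
    · intro a b hab
      simpa [hℓ] using hab
    · rintro _ ⟨k, rfl⟩
      exact h1 k j
  rw [h5, Finsupp.sum_zero_index] at hP
  rw [← one_mul E, ← DReg.xinv_pow_mul_x_pow N, mul_assoc, hP, mul_zero]

/-! ### Monomials in commuting elements -/

section Monomials

variable {ι : Type} [Fintype ι]

lemma pi_nat_induction [DecidableEq ι] {P : (ι → ℕ) → Prop} (zero : P 0)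
    (step : ∀ α i, P α → P (α + Pi.single i 1)) (α : ι → ℕ) : P α := by
  obtain ⟨n, hn⟩ : ∃ n, ∑ i, α i = n := ⟨_, rfl⟩
  induction n generalizing α with
  | zero =>
    have : α = 0 := by
      ext i
      simpa using (Finset.sum_eq_zero_iff.1 hn) i (Finset.mem_univ i)
    exact this ▸ zero
  | succ n ih =>
    obtain ⟨i, -, hi⟩ := Finset.exists_ne_zero_of_sum_ne_zero (hn.trans_ne n.succ_ne_zero)
    have h : α = (α - Pi.single i 1) + Pi.single i 1 := by
      ext j
      by_cases hj : j = i
      · subst hj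
        simp
        omega
      · simp [hj]
    rw [h]
    refine step _ _ (ih _ ?_)
    rw [h] at hn
    simp only [Pi.add_apply, Finset.sum_add_distrib, Finset.sum_pi_single', Finset.mem_univ,
      if_true] at hn
    omega

variable {M : Type*} [Monoid M]

lemma pairwise_commute_pow (g : ι → M) (h : ∀ i j, Commute (g i) (g j)) (α : ι → ℕ) :
    ((Finset.univ : Finset ι) : Set ι).Pairwise (Function.onFun Commute fun i => g i ^ α i) :=
  fun i _ j _ _ => (h i j).pow_pow _ _

/-- The monomial `∏ (g i)^(α i)` in pairwise commuting elements. -/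
def commMonomial (g : ι → M) (h : ∀ i j, Commute (g i) (g j)) (α : ι → ℕ) : M :=
  Finset.univ.noncommProd (fun i => g i ^ α i) (pairwise_commute_pow g h α)

variable (g : ι → M) (h : ∀ i j, Commute (g i) (g j))

lemma commMonomial_zero : commMonomial g h 0 = 1 := by
  rw [commMonomial, Finset.noncommProd_eq_pow_card _ _ _ 1 (by simp), one_pow]

lemma commMonomial_add (α β : ι → ℕ) :
    commMonomial g h (α + β) = commMonomial g h α * commMonomial g h β := by
  rw [commMonomial, commMonomial, commMonomial, ← Finset.noncommProd_mul_distrib]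
  · exact Finset.noncommProd_congr rfl (fun i _ => pow_add _ _ _) _
  · exact fun i _ j _ _ => (h i j).pow_pow _ _

lemma commMonomial_single [DecidableEq ι] (i : ι) : commMonomial g h (Pi.single i 1) = g i := by
  have h1 : ∀ comm, (Finset.univ.erase i).noncommProd
      (fun j => g j ^ (Pi.single i 1 : ι → ℕ) j) comm = 1 := fun comm => by
    rw [Finset.noncommProd_eq_pow_card _ _ _ 1, one_pow]
    intro j hj
    simp [Finset.ne_of_mem_erase hj]
  refine (Finset.mul_noncommProd_erase _ (Finset.mem_univ i) _ _).symm.trans ?_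
  exact (congrArg _ (h1 _)).trans (by simp)

lemma commMonomial_nsmul (n : ℕ) (α : ι → ℕ) :
    commMonomial g h (n • α) = commMonomial g h α ^ n := by
  induction n with
  | zero => rw [zero_smul, commMonomial_zero, pow_zero]
  | succ n ih => rw [succ_nsmul, commMonomial_add, ih, pow_succ]

end Monomials

/-! ### The Weyl algebra -/

namespace Weyl

variable {ι : Type} [DecidableEq ι]

lemma a_comm (i j : ι) : Commute (a i) (a j) := by
  simpa [a, Commute, SemiconjBy] using RingQuot.mkAlgHom_rel ℂ (WeylRel.coord i j)

lemma d_comm (i j : ι) : Commute (d i) (d j) := by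
  simpa [d, Commute, SemiconjBy] using RingQuot.mkAlgHom_rel ℂ (WeylRel.deriv i j)

lemma d_mul_a (i j : ι) : d i * a j = a j * d i + if i = j then 1 else 0 := by
  have := RingQuot.mkAlgHom_rel ℂ (WeylRel.mixed i j)
  simpa [d, a, apply_ite] using this

/-- The Euler operator `a i ∂ i`. -/
def euler (i : ι) : Weyl ι := a i * d i

lemma euler_mul_a (i j : ι) : euler i * a j = a j * euler i + if i = j then a j else 0 := by
  rw [euler, mul_assoc, d_mul_a, mul_add, ← mul_assoc, (a_comm i j).eq, mul_assoc]
  congr 1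
  split_ifs with h <;> simp [h]

lemma euler_mul_d (i j : ι) : euler i * d j = d j * euler i - if i = j then d j else 0 := by
  rw [euler, mul_assoc, (d_comm i j).eq, ← mul_assoc, ← mul_assoc, d_mul_a, add_mul]
  split_ifs with h1 h2 h2 <;> simp_all

variable [Fintype ι]

/-- The monomial `∏ (a i)^(α i)`. -/
def monA (α : ι → ℕ) : Weyl ι := commMonomial a a_comm α

/-- The monomial `∏ (∂ i)^(α i)`. -/
def monD (α : ι → ℕ) : Weyl ι := commMonomial d d_comm α

lemma monA_add_single (α : ι → ℕ) (i : ι) : monA (α + Pi.single i 1) = monA α * a i := by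
  rw [monA, monA, commMonomial_add, commMonomial_single]

lemma monD_add_single (α : ι → ℕ) (i : ι) : monD (α + Pi.single i 1) = d i * monD α := by
  rw [monD, monD, add_comm, commMonomial_add, commMonomial_single]

lemma a_mul_monA (α : ι → ℕ) (i : ι) : a i * monA α = monA (α + Pi.single i 1) := by
  rw [monA, monA, add_comm, commMonomial_add, commMonomial_single]

lemma monD_add_single' (α : ι → ℕ) (i : ι) : monD (α + Pi.single i 1) = monD α * d i := by
  rw [monD, monD, commMonomial_add, commMonomial_single]

lemma euler_mul_monA (i : ι) (α : ι → ℕ) :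
    euler i * monA α = monA α * euler i + (α i : ℂ) • monA α := by
  induction α using pi_nat_induction with
  | zero => simp [monA, commMonomial_zero]
  | step α j ih =>
    rw [monA_add_single, ← mul_assoc, ih, add_mul, mul_assoc, euler_mul_a, mul_add, ← mul_assoc,
      smul_mul_assoc, add_assoc]
    congr 1
    by_cases h : i = j
    · subst h
      simp [add_smul, add_comm]
    · simp [h]

lemma euler_mul_monD (i : ι) (α : ι → ℕ) :
    euler i * monD α = monD α * euler i - (α i : ℂ) • monD α := by
  induction α using pi_nat_induction with
  | zero => simp [monD, commMonomial_zero]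
  | step α j ih =>
    rw [monD_add_single', ← mul_assoc, ih, sub_mul, mul_assoc, euler_mul_d, mul_sub, ← mul_assoc,
      smul_mul_assoc, sub_sub]
    congr 1
    by_cases h : i = j
    · subst h
      simp [add_smul, add_comm]
    · simp [h]

/-- It suffices to know that the commutator is a polynomial in the `a_j`; the exact formula would
involve the exponent `α - e_i`, which needs care when `α i = 0`. -/
lemma d_mul_monA (i : ι) (α : ι → ℕ) :
    d i * monA α - monA α * d i ∈ Submodule.span ℂ (Set.range (monA (ι := ι))) := by
  induction α using pi_nat_induction with
  | zero => simp [monA, commMonomial_zero]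
  | step α j ih =>
    have h1 : d i * monA (α + Pi.single j 1) - monA (α + Pi.single j 1) * d i
        = a j * (d i * monA α - monA α * d i) + if i = j then monA α else 0 := by
      rw [← a_mul_monA, ← mul_assoc, d_mul_a, add_mul, mul_sub, mul_assoc, mul_assoc]
      split_ifs <;> simp [sub_add_eq_add_sub]
    rw [h1]
    refine Submodule.add_mem _ ?_ ?_
    · have h2 : Submodule.span ℂ (Set.range (monA (ι := ι))) ≤
          (Submodule.span ℂ (Set.range (monA (ι := ι)))).comap (LinearMap.mulLeft ℂ (a j)) := by
        rw [Submodule.span_le]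
        rintro _ ⟨β, rfl⟩
        exact Submodule.subset_span ⟨_, (a_mul_monA β j).symm⟩
      exact h2 ih
    · split_ifs
      · exact Submodule.subset_span ⟨α, rfl⟩
      · exact Submodule.zero_mem _

/-- Normal ordering: the span contains `1` and is stable under left multiplication by the
generators. Linear independence of the monomials is not needed anywhere. -/
lemma span_monA_mul_monD : Submodule.span ℂ
    (Set.range fun s : (ι → ℕ) × (ι → ℕ) => monA s.1 * monD s.2) = ⊤ := by
  set N := Submodule.span ℂ (Set.range fun s : (ι → ℕ) × (ι → ℕ) => monA s.1 * monD s.2) with hN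
  have hmem : ∀ α β, monA α * monD β ∈ N := fun α β => Submodule.subset_span ⟨(α, β), rfl⟩
  have key : ∀ u : Weyl ι, (∀ α β, u * (monA α * monD β) ∈ N) → ∀ D ∈ N, u * D ∈ N := by
    intro u hu
    change N ≤ N.comap (LinearMap.mulLeft ℂ u)
    rw [hN, Submodule.span_le]
    rintro _ ⟨⟨α, β⟩, rfl⟩
    exact hu α β
  have hA : ∀ p ∈ Submodule.span ℂ (Set.range (monA (ι := ι))), ∀ β, p * monD β ∈ N := by
    intro p hp β
    have h2 : Submodule.span ℂ (Set.range (monA (ι := ι))) ≤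
        N.comap (LinearMap.mulRight ℂ (monD β)) := by
      rw [Submodule.span_le]
      rintro _ ⟨α, rfl⟩
      exact hmem α β
    exact h2 hp
  rw [eq_top_iff]
  rintro D -
  obtain ⟨w, rfl⟩ := RingQuot.mkAlgHom_surjective ℂ (WeylRel ι) D
  suffices h : ∀ D ∈ N, RingQuot.mkAlgHom ℂ (WeylRel ι) w * D ∈ N by
    have := h 1 (by simpa [monA, monD, commMonomial_zero] using hmem 0 0)
    simpa using this
  induction w using FreeAlgebra.induction with
  | grade0 r =>
    intro D hD
    rw [AlgHom.commutes, ← Algebra.smul_def]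
    exact N.smul_mem _ hD
  | grade1 g =>
    cases g with
    | inl i =>
      refine key (a i) fun α β => ?_
      rw [← mul_assoc, a_mul_monA]
      exact hmem _ _
    | inr i =>
      refine key (d i) fun α β => ?_
      have h1 : d i * (monA α * monD β)
          = monA α * monD (β + Pi.single i 1) + (d i * monA α - monA α * d i) * monD β := by
        rw [monD_add_single, sub_mul, mul_assoc, mul_assoc]
        abel
      rw [h1]
      exact N.add_mem (hmem _ _) (hA _ (d_mul_monA i α) β)
  | mul a b ha hb =>
    intro D hD
    rw [map_mul, mul_assoc]
    exact ha _ (hb _ hD)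
  | add a b ha hb =>
    intro D hD
    rw [map_add, add_mul]
    exact N.add_mem (ha _ hD) (hb _ hD)

/-- The new factor `a_i ∂_i` appears between `a^α` and `∂^α`; moving it to the left past `a^α`
shifts it by `α i`. Iterating gives falling factorials in the Euler operators. -/
lemma monA_mul_monD_add_single (α : ι → ℕ) (i : ι) :
    monA (α + Pi.single i 1) * monD (α + Pi.single i 1)
      = (euler i - (α i : ℂ) • 1) * (monA α * monD α) := by
  rw [monA_add_single, monD_add_single, mul_assoc, ← mul_assoc (a i), ← euler, ← mul_assoc,
    ← mul_assoc, sub_mul, euler_mul_monA, smul_mul_assoc, one_mul, add_sub_cancel_right]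

lemma monA_mul_monD_mem (α : ι → ℕ) :
    monA α * monD α ∈ Algebra.adjoin ℂ (Set.range (euler (ι := ι))) := by
  induction α using pi_nat_induction with
  | zero => simp [monA, monD, commMonomial_zero]
  | step α i ih =>
    rw [monA_mul_monD_add_single]
    exact mul_mem (sub_mem (Algebra.subset_adjoin ⟨i, rfl⟩) (Subalgebra.smul_mem _ (one_mem _) _)) ih

end Weyl

/-! ### Invariant differential operators -/

lemma aeval_apply_of_apply_eq_smul {V : Type*} [AddCommGroup V] [Module ℂ V] {T : Module.End ℂ V}
    {v : V} {μ : ℂ} (h : T v = μ • v) (p : ℂ[X]) : Polynomial.aeval T p v = p.eval μ • v := by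
  by_cases hv : v = 0
  · simp [hv]
  · exact Module.End.aeval_apply_of_hasEigenvector ⟨Module.End.mem_eigenspace_iff.2 h, hv⟩

/-- If a sum of eigenvectors lies in the kernel, the eigenvectors with nonzero eigenvalues can be
left out. -/
lemma sum_eq_sum_filter_of_apply_eq_zero {V κ : Type*} [AddCommGroup V] [Module ℂ V]
    {T : Module.End ℂ V} {v : κ → V} {μ : κ → ℂ} (h : ∀ s, T (v s) = μ s • v s) (S : Finset κ)
    (h0 : T (∑ s ∈ S, v s) = 0) : ∑ s ∈ S, v s = ∑ s ∈ S with μ s = 0, v s := by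
  -- `p` has `p(0) = 1` and vanishes at every nonzero eigenvalue, so `p(T)` fixes the sum, which
  -- lies in the kernel, and kills the unwanted terms.
  set p : ℂ[X] := ∏ s ∈ S with μ s ≠ 0, (1 - Polynomial.C (μ s)⁻¹ * Polynomial.X) with hp
  have h1 : Polynomial.aeval T p (∑ s ∈ S, v s) = ∑ s ∈ S, v s := by
    rw [aeval_apply_of_apply_eq_smul (μ := 0) (by rw [h0, zero_smul])]
    simp [hp, Polynomial.eval_prod]
  rw [← h1, map_sum, Finset.sum_filter]
  refine Finset.sum_congr rfl fun s hs => ?_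
  rw [aeval_apply_of_apply_eq_smul (h s)]
  split_ifs with hμ
  · simp [hp, hμ, Polynomial.eval_prod]
  · rw [hp, Polynomial.eval_prod, Finset.prod_eq_zero (Finset.mem_filter.2 ⟨hs, hμ⟩), zero_smul]
    simp [hμ]

variable {ℓ : ℕ} [NeZero ℓ]

lemma eq_zero_apply_of_forall_eq {X : Type*} (δ : Fin ℓ → X) (h : ∀ k, δ (k + 1) = δ k)
    (k : Fin ℓ) : δ k = δ 0 := by
  obtain ⟨n, hn⟩ := k
  induction n with
  | zero => rfl
  | succ n ih =>
    rw [← ih (by omega), ← h ⟨n, by omega⟩]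
    congr 1
    ext
    exact (Fin.val_add_one_of_lt' (i := ⟨n, by omega⟩) hn).symm

open Weyl

lemma lieOp_eq (ξ : Fin ℓ → ℂ) : lieOp ξ = ∑ i, (ξ i - ξ (i + 1)) • euler i := rfl

/-- The normally ordered monomials are weight vectors for the adjoint action of the torus. -/
lemma lieOp_mul_monA_mul_monD (ξ : Fin ℓ → ℂ) (α β : Fin ℓ → ℕ) :
    lieOp ξ * (monA α * monD β) - monA α * monD β * lieOp ξ
      = (∑ i, (ξ i - ξ (i + 1)) * ((α i : ℂ) - β i)) • (monA α * monD β) := by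
  rw [lieOp_eq, Finset.sum_mul, Finset.mul_sum, ← Finset.sum_sub_distrib, Finset.sum_smul]
  refine Finset.sum_congr rfl fun i _ => ?_
  rw [smul_mul_assoc, mul_smul_comm, mul_smul]
  refine (smul_sub (ξ i - ξ (i + 1)) (euler i * (monA α * monD β))
    (monA α * monD β * euler i)).symm.trans ?_
  congr 1
  rw [← mul_assoc, euler_mul_monA, add_mul, mul_assoc, euler_mul_monD, mul_sub, smul_mul_assoc,
    mul_smul_comm, sub_smul, mul_assoc]
  abel

lemma mem_invariantOps_iff (D : Weyl (Fin ℓ)) :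
    D ∈ invariantOps ℓ ↔ ∀ ξ : Fin ℓ → ℂ, lieOp ξ * D - D * lieOp ξ = 0 := by
  simp [invariantOps, Subalgebra.mem_centralizer_iff, sub_eq_zero]

/-- The generators of the algebra of invariant differential operators. -/
def invariantGens (ℓ : ℕ) : Set (Weyl (Fin ℓ)) :=
  {monA 1, monD 1} ∪ Set.range euler

/-- If the common difference is `n ≥ 0`, the monomial is `(∏ a_i)^n a^β ∂^β`; otherwise it is `a^α
∂^α (∏ ∂_i)^(-n)`. The diagonal factors are polynomials in the Euler operators. -/
lemma monA_mul_monD_mem_adjoin (α β : Fin ℓ → ℕ) (h : ∀ i, (α i : ℂ) - β i = α 0 - β 0) :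
    monA α * monD β ∈ Algebra.adjoin ℂ (invariantGens ℓ) := by
  have h' : ∀ i, α i + β 0 = α 0 + β i := fun i => by
    have := h i
    rw [sub_eq_sub_iff_add_eq_add] at this
    exact_mod_cast this
  have hE : ∀ γ : Fin ℓ → ℕ, monA γ * monD γ ∈ Algebra.adjoin ℂ (invariantGens ℓ) := fun γ =>
    Algebra.adjoin_mono Set.subset_union_right (monA_mul_monD_mem γ)
  rcases le_total (β 0) (α 0) with h0 | h0
  · have h1 : α = (α 0 - β 0) • 1 + β := by
      ext i
      have := h' i
      simp
      omega
    rw [h1, monA, commMonomial_add, commMonomial_nsmul, mul_assoc]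
    exact mul_mem (pow_mem (Algebra.subset_adjoin (by simp [invariantGens, monA])) _) (hE β)
  · have h1 : β = α + (β 0 - α 0) • 1 := by
      ext i
      have := h' i
      simp
      omega
    rw [h1, monD, commMonomial_add, commMonomial_nsmul, ← mul_assoc]
    exact mul_mem (hE α) (pow_mem (Algebra.subset_adjoin (by simp [invariantGens, monD])) _)

lemma monA_mul_monD_mem_invariantOps (α β : Fin ℓ → ℕ) (h : ∀ i, (α i : ℂ) - β i = α 0 - β 0) :
    monA α * monD β ∈ invariantOps ℓ := by
  rw [mem_invariantOps_iff]
  intro ξ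
  rw [lieOp_mul_monA_mul_monD]
  have h1 := Equiv.sum_comp (Equiv.addRight (1 : Fin ℓ)) ξ
  simp only [Equiv.coe_addRight] at h1
  simp only [h]
  rw [← Finset.sum_mul, Finset.sum_sub_distrib, h1, sub_self, zero_mul, zero_smul]

lemma invariantOps_le_adjoin :
    invariantOps ℓ ≤ Algebra.adjoin ℂ (invariantGens ℓ) := by
  intro D hD
  have hmem : D ∈ Submodule.span ℂ
      (Set.range fun s : (Fin ℓ → ℕ) × (Fin ℓ → ℕ) => monA s.1 * monD s.2) := by
    rw [span_monA_mul_monD]; trivial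
  obtain ⟨P, hP⟩ := Finsupp.mem_span_range_iff_exists_finsupp.1 hmem
  set v := fun s : (Fin ℓ → ℕ) × (Fin ℓ → ℕ) => P s • (monA s.1 * monD s.2)
  -- The terms of nonzero weight are discarded for one basis vector of the Lie algebra at a time.
  have key : ∀ K : Finset (Fin ℓ), ∃ S : Finset ((Fin ℓ → ℕ) × (Fin ℓ → ℕ)), D = ∑ s ∈ S, v s ∧
      ∀ s ∈ S, ∀ k ∈ K, ∑ i, ((Pi.single k 1 : Fin ℓ → ℂ) i - (Pi.single k 1 : Fin ℓ → ℂ) (i + 1))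
        * ((s.1 i : ℂ) - s.2 i) = 0 := by
    intro K
    induction K using Finset.induction_on with
    | empty => exact ⟨P.support, hP.symm, by simp⟩
    | insert k K _ ih =>
      classical
      obtain ⟨S, hS, hS'⟩ := ih
      have := sum_eq_sum_filter_of_apply_eq_zero (v := v)
        (T := LinearMap.mulLeft ℂ (lieOp (Pi.single k 1))
          - LinearMap.mulRight ℂ (lieOp (Pi.single k 1)))
        (fun s => by
          simp only [v, map_smul, LinearMap.sub_apply, LinearMap.mulLeft_apply,
            LinearMap.mulRight_apply, lieOp_mul_monA_mul_monD]
          exact smul_comm _ _ _) S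
        (by rw [← hS]; exact (mem_invariantOps_iff D).1 hD _)
      refine ⟨_, hS.trans this, fun s hs j hj => ?_⟩
      rw [Finset.mem_filter] at hs
      rcases Finset.mem_insert.1 hj with rfl | hj
      · exact hs.2
      · exact hS' s hs.1 j hj
  obtain ⟨S, hS, hS'⟩ := key Finset.univ
  rw [hS]
  refine sum_mem fun s hs => Subalgebra.smul_mem _ (monA_mul_monD_mem_adjoin _ _ ?_) _
  refine eq_zero_apply_of_forall_eq (fun i => (s.1 i : ℂ) - s.2 i) fun k => ?_
  -- For the basis vector at `k + 1`, the coefficients `ξ_i - ξ_{i+1}` give the weight as the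
  -- difference of `α - β` at `k + 1` and at `k`.
  have := hS' s hs (k + 1) (Finset.mem_univ _)
  simp only [sub_mul, Finset.sum_sub_distrib, Pi.single_apply, add_left_inj] at this
  simpa [sub_eq_zero] using this

lemma adjoin_invariantGens : Algebra.adjoin ℂ (invariantGens ℓ) = invariantOps ℓ := by
  refine le_antisymm (Algebra.adjoin_le ?_) invariantOps_le_adjoin
  rintro _ ((rfl | rfl) | ⟨i, rfl⟩)
  · simpa [monD, commMonomial_zero] using monA_mul_monD_mem_invariantOps (ℓ := ℓ) 1 0 (by simp)
  · simpa [monA, commMonomial_zero] using monA_mul_monD_mem_invariantOps (ℓ := ℓ) 0 1 (by simp)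
  · have := monA_mul_monD_mem_invariantOps (Pi.single i 1) (Pi.single i 1) (by simp)
    rwa [monA, monD, commMonomial_single, commMonomial_single] at this

/-! ### Restriction to the slice -/

section Restriction

variable {ℓ : ℕ}

lemma resPoly_monomial (α : Fin ℓ →₀ ℕ) (z : ℂ) :
    resPoly (MvPolynomial.monomial α z) = Polynomial.monomial α.degree z := by
  rw [resPoly, MvPolynomial.aeval_monomial, Finsupp.prod, Finset.prod_pow_eq_pow_sum,
    ← Polynomial.C_mul_X_pow_eq_monomial]
  rfl

/-- The derivation `a i ∂ i` of the polynomial ring. -/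
def eulerPoly (i : Fin ℓ) : Derivation ℂ (MvPolynomial (Fin ℓ) ℂ) (MvPolynomial (Fin ℓ) ℂ) :=
  (MvPolynomial.X i : MvPolynomial (Fin ℓ) ℂ) • MvPolynomial.pderiv i

/-- The derivation `a i ∂ i` of the field of rational functions. -/
def eulerRat (i : Fin ℓ) : Derivation ℂ (RatA ℓ) (RatA ℓ) :=
  coordA i • fracDeriv (MvPolynomial.pderiv i)

lemma eulerRat_algebraMap (i : Fin ℓ) (p : MvPolynomial (Fin ℓ) ℂ) :
    eulerRat i (algebraMap _ (RatA ℓ) p) = algebraMap _ (RatA ℓ) (eulerPoly i p) := by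
  rw [eulerRat, Derivation.smul_apply, fracDeriv_algebraMap, eulerPoly, Derivation.smul_apply,
    smul_eq_mul, smul_eq_mul, map_mul, coordA]

lemma eulerPoly_monomial (i : Fin ℓ) (α : Fin ℓ →₀ ℕ) (z : ℂ) :
    eulerPoly i (MvPolynomial.monomial α z) = (α i : ℂ) • MvPolynomial.monomial α z := by
  rw [eulerPoly, Derivation.smul_apply, smul_eq_mul, MvPolynomial.X_mul_pderiv_monomial,
    Nat.cast_smul_eq_nsmul]

lemma coeff_eulerPoly (i : Fin ℓ) (p : MvPolynomial (Fin ℓ) ℂ) (α : Fin ℓ →₀ ℕ) :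
    (eulerPoly i p).coeff α = α i * p.coeff α := by
  induction p using MvPolynomial.induction_on' with
  | monomial β z =>
    rw [eulerPoly_monomial, MvPolynomial.coeff_smul, MvPolynomial.coeff_monomial, smul_eq_mul]
    split_ifs with h
    · rw [h]
    · simp
  | add p q hp hq => rw [map_add, MvPolynomial.coeff_add, hp, hq, MvPolynomial.coeff_add, mul_add]

/-- Both sides multiply a monomial by its total degree. A single `a_i ∂_i` is in general not tangent
to the slice; the sum is. -/
lemma resPoly_sum_eulerPoly (p : MvPolynomial (Fin ℓ) ℂ) :
    resPoly (∑ i, eulerPoly i p) = Polynomial.X * Polynomial.derivative (resPoly p) := by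
  induction p using MvPolynomial.induction_on' with
  | monomial α z =>
    simp only [eulerPoly_monomial]
    rw [← Finset.sum_smul, map_smul, resPoly_monomial, Polynomial.derivative_monomial,
      Polynomial.X_mul_monomial, Polynomial.smul_monomial, ← Nat.cast_sum,
      ← Finsupp.degree_eq_sum]
    rcases Nat.eq_zero_or_pos α.degree with h | h
    · simp [h]
    · rw [Nat.sub_add_cancel h, smul_eq_mul, mul_comm]
  | add p q hp hq => simp only [map_add, Finset.sum_add_distrib] at *; rw [hp, hq, mul_add]

/-- A polynomial whose monomials have different degrees is not identically zero on the slice. -/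
lemma resPoly_ne_zero {p : MvPolynomial (Fin ℓ) ℂ} (hp : p ≠ 0)
    (h : ∀ α ∈ p.support, ∀ β ∈ p.support, α.degree = β.degree → α = β) : resPoly p ≠ 0 := by
  obtain ⟨α, hα⟩ := MvPolynomial.support_nonempty.2 hp
  intro h0
  have h1 : (resPoly p).coeff α.degree = p.coeff α := by
    conv_lhs => rw [p.as_sum]
    simp only [map_sum, resPoly_monomial, Polynomial.finsetSum_coeff, Polynomial.coeff_monomial]
    rw [Finset.sum_eq_single_of_mem α hα, if_pos rfl]
    intro β hβ hne
    rw [if_neg fun hd => hne (h β hβ α hα hd)]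
  rw [h0, Polynomial.coeff_zero] at h1
  exact MvPolynomial.mem_support_iff.1 hα h1.symm

/-- The rational function `f` is defined at the generic point of the slice. -/
def IsRegular (f : RatA ℓ) : Prop :=
  resPoly (IsFractionRing.den (MvPolynomial (Fin ℓ) ℂ) f : MvPolynomial (Fin ℓ) ℂ) ≠ 0

lemma algebraMap_resPoly_ne_zero {b : MvPolynomial (Fin ℓ) ℂ} (hb : resPoly b ≠ 0) :
    algebraMap ℂ[X] RatX (resPoly b) ≠ 0 := by
  simpa using hb

lemma algebraMap_num_eq (f : RatA ℓ) :
    f * algebraMap _ (RatA ℓ) (IsFractionRing.den (MvPolynomial (Fin ℓ) ℂ) f :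
      MvPolynomial (Fin ℓ) ℂ) = algebraMap _ _ (IsFractionRing.num (MvPolynomial (Fin ℓ) ℂ) f) := by
  have h : algebraMap _ (RatA ℓ) (IsFractionRing.den (MvPolynomial (Fin ℓ) ℂ) f :
      MvPolynomial (Fin ℓ) ℂ) ≠ 0 := by simp
  exact (div_eq_iff h).1 (IsFractionRing.mk'_num_den' (MvPolynomial (Fin ℓ) ℂ) f) |>.symm

/-- Restriction may be computed from any fraction whose denominator survives on the slice, since the
reduced denominator divides that one. This frees later arguments from lowest terms. -/
lemma isRegular_and_resRat_eq {f : RatA ℓ} {a b : MvPolynomial (Fin ℓ) ℂ} (hb : resPoly b ≠ 0)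
    (h : f * algebraMap _ _ b = algebraMap _ _ a) :
    IsRegular f ∧
      resRat f = algebraMap ℂ[X] RatX (resPoly a) / algebraMap ℂ[X] RatX (resPoly b) := by
  set n := IsFractionRing.num (MvPolynomial (Fin ℓ) ℂ) f with hn
  set d := (IsFractionRing.den (MvPolynomial (Fin ℓ) ℂ) f : MvPolynomial (Fin ℓ) ℂ) with hd
  have h1 : n * b = a * d := by
    apply IsFractionRing.injective (MvPolynomial (Fin ℓ) ℂ) (RatA ℓ)
    rw [map_mul, map_mul, ← h, ← algebraMap_num_eq f]
    ring
  have h2 : d ∣ b := by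
    refine (IsFractionRing.num_den_reduced (MvPolynomial (Fin ℓ) ℂ) f).symm.dvd_of_dvd_mul_left ?_
    exact Dvd.intro_left a h1.symm
  have h3 : resPoly d ≠ 0 := fun h0 => hb (zero_dvd_iff.1 (h0 ▸ map_dvd resPoly h2))
  refine ⟨h3, ?_⟩
  rw [resRat, div_eq_div_iff (algebraMap_resPoly_ne_zero h3) (algebraMap_resPoly_ne_zero hb),
    ← map_mul, ← map_mul, ← map_mul, ← map_mul, h1]

lemma IsRegular.exists_eq {f : RatA ℓ} (hf : IsRegular f) : ∃ a b : MvPolynomial (Fin ℓ) ℂ,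
    resPoly b ≠ 0 ∧ f * algebraMap _ _ b = algebraMap _ _ a ∧
      resRat f * algebraMap ℂ[X] RatX (resPoly b) = algebraMap ℂ[X] RatX (resPoly a) :=
  ⟨_, _, hf, algebraMap_num_eq f, div_mul_cancel₀ _ (algebraMap_resPoly_ne_zero hf)⟩

lemma resRat_add {f g : RatA ℓ} (hf : IsRegular f) (hg : IsRegular g) :
    resRat (f + g) = resRat f + resRat g := by
  obtain ⟨a, b, hb, h, h'⟩ := hf.exists_eq
  obtain ⟨p, q, hq, k, k'⟩ := hg.exists_eq
  have hbq : resPoly (b * q) ≠ 0 := by rw [map_mul]; exact mul_ne_zero hb hq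
  rw [(isRegular_and_resRat_eq (a := a * q + p * b) hbq _).2,
    div_eq_iff (algebraMap_resPoly_ne_zero hbq)]
  · simp only [map_add, map_mul, ← h', ← k']
    ring
  · simp only [map_add, map_mul, ← h, ← k]
    ring

lemma resRat_mul {f g : RatA ℓ} (hf : IsRegular f) (hg : IsRegular g) :
    resRat (f * g) = resRat f * resRat g := by
  obtain ⟨a, b, hb, h, h'⟩ := hf.exists_eq
  obtain ⟨p, q, hq, k, k'⟩ := hg.exists_eq
  have hbq : resPoly (b * q) ≠ 0 := by rw [map_mul]; exact mul_ne_zero hb hq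
  rw [(isRegular_and_resRat_eq (a := a * p) hbq _).2, div_eq_iff (algebraMap_resPoly_ne_zero hbq)]
  · simp only [map_mul, ← h', ← k']
    ring
  · simp only [map_mul, ← h, ← k]
    ring

lemma isRegular_and_resRat_algebraMap (p : MvPolynomial (Fin ℓ) ℂ) :
    IsRegular (algebraMap _ (RatA ℓ) p) ∧
      resRat (algebraMap _ (RatA ℓ) p) = algebraMap ℂ[X] RatX (resPoly p) := by
  simpa using isRegular_and_resRat_eq (f := algebraMap _ (RatA ℓ) p) (a := p) (b := 1) (by simp)
    (by simp)

lemma resRat_smul (z : ℂ) {f : RatA ℓ} (hf : IsRegular f) : resRat (z • f) = z • resRat f := by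
  have h := isRegular_and_resRat_algebraMap (ℓ := ℓ) (MvPolynomial.C z)
  rw [Algebra.smul_def, IsScalarTower.algebraMap_apply ℂ (MvPolynomial (Fin ℓ) ℂ),
    MvPolynomial.algebraMap_eq, resRat_mul h.1 hf, h.2, Algebra.smul_def,
    IsScalarTower.algebraMap_apply ℂ ℂ[X] RatX]
  congr 2
  exact resPoly.commutes z

/-- The quotient rule carries `resPoly_sum_eulerPoly` over to fractions. -/
lemma resRat_sum_eulerRat {f : RatA ℓ} (hf : IsRegular f) : resRat (∑ i, eulerRat i f)
    = coordX * fracDeriv (Polynomial.derivative' (R := ℂ)) (resRat f) := by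
  obtain ⟨a, b, hb, h, h'⟩ := hf.exists_eq
  have hbb : resPoly (b * b) ≠ 0 := by rw [map_mul]; exact mul_ne_zero hb hb
  have h1 : ∀ i, eulerRat i f * algebraMap _ _ b + f * algebraMap _ _ (eulerPoly i b)
      = algebraMap _ _ (eulerPoly i a) := by
    intro i
    rw [← eulerRat_algebraMap i a, ← h, Derivation.leibniz, eulerRat_algebraMap]
    simp only [smul_eq_mul]
    ring
  have h2 : (∑ i, eulerRat i f) * algebraMap _ _ b + f * algebraMap _ _ (∑ i, eulerPoly i b)
      = algebraMap _ _ (∑ i, eulerPoly i a) := by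
    rw [map_sum, map_sum, Finset.sum_mul, Finset.mul_sum, ← Finset.sum_add_distrib]
    exact Finset.sum_congr rfl fun i _ => h1 i
  have h3 : fracDeriv (Polynomial.derivative' (R := ℂ)) (resRat f)
        * algebraMap ℂ[X] RatX (resPoly b)
      + resRat f * algebraMap ℂ[X] RatX (Polynomial.derivative (resPoly b))
      = algebraMap ℂ[X] RatX (Polynomial.derivative (resPoly a)) := by
    have := fracDeriv_algebraMap (Polynomial.derivative' (R := ℂ)) (resPoly a)
    rw [← h', Derivation.leibniz, fracDeriv_algebraMap] at this
    simp only [smul_eq_mul, Polynomial.derivative'_apply] at this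
    rw [← this]
    ring
  rw [(isRegular_and_resRat_eq (a := (∑ i, eulerPoly i a) * b - a * ∑ i, eulerPoly i b) hbb _).2,
    div_eq_iff (algebraMap_resPoly_ne_zero hbb)]
  · simp only [map_sub, map_mul, resPoly_sum_eulerPoly]
    rw [← h3, ← h', coordX]
    ring
  · simp only [map_sub, map_mul]
    rw [← h2, ← h]
    ring

lemma actA_euler (r : Fin ℓ → ℂ) (i : Fin ℓ) (f : RatA ℓ) :
    actA r (Weyl.euler i) f = eulerRat i f + r i • f := by
  simp [actA, Weyl.euler, Weyl.a, Weyl.d, twistedPartial, eulerRat, mul_add,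
    mul_inv_cancel_left₀ (coordA_ne_zero i)]

lemma actA_a (r : Fin ℓ → ℂ) (i : Fin ℓ) (f : RatA ℓ) : actA r (Weyl.a i) f = coordA i * f := by
  simp [actA, Weyl.a]

/-- The operator `a_i ∂_i - a_j ∂_j` rescales each monomial, so it does not raise the total degree.
The quotient is therefore a constant, `p` is an eigenvector, and its monomials share one eigenvalue.
-/
lemma sub_eq_sub_of_dvd_eulerPoly_sub {p : MvPolynomial (Fin ℓ) ℂ} {i j : Fin ℓ}
    (h : p ∣ (eulerPoly i - eulerPoly j) p) {α β : Fin ℓ →₀ ℕ} (hα : α ∈ p.support)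
    (hβ : β ∈ p.support) : (α i : ℂ) - α j = β i - β j := by
  have hp : p ≠ 0 := by
    rintro rfl
    simp at hα
  have hc : ∀ γ, ((eulerPoly i - eulerPoly j) p).coeff γ = ((γ i : ℂ) - γ j) * p.coeff γ := by
    intro γ
    rw [Derivation.sub_apply, MvPolynomial.coeff_sub, coeff_eulerPoly, coeff_eulerPoly, sub_mul]
  obtain ⟨q, hq⟩ := h
  obtain ⟨z, hz⟩ : ∃ z, q = MvPolynomial.C z := by
    by_cases hq0 : q = 0
    · exact ⟨0, by simp [hq0]⟩
    refine ⟨_, MvPolynomial.totalDegree_eq_zero_iff_eq_C.1 ?_⟩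
    have h1 : ((eulerPoly i - eulerPoly j) p).totalDegree ≤ p.totalDegree := by
      refine MvPolynomial.totalDegree_le_of_support_subset fun γ hγ => ?_
      rw [MvPolynomial.mem_support_iff, hc] at hγ
      exact MvPolynomial.mem_support_iff.2 (right_ne_zero_of_mul hγ)
    rw [hq, MvPolynomial.totalDegree_mul_of_isDomain hp hq0] at h1
    omega
  have key : ∀ γ ∈ p.support, (γ i : ℂ) - γ j = z := by
    intro γ hγ
    have h1 := hc γ
    rw [hq, hz, mul_comm p, MvPolynomial.coeff_C_mul] at h1
    exact (mul_right_cancel₀ (MvPolynomial.mem_support_iff.1 hγ) h1).symm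
  rw [key α hα, key β hβ]

/-- For `f = n / d` and `T = a_i ∂_i - a_j ∂_j`, the equation `T f = 0` reads `n T(d) = T(n) d`, and
`n` is coprime to `d`. -/
lemma den_dvd_eulerPoly_sub {f : RatA ℓ} {i j : Fin ℓ} (h : eulerRat i f = eulerRat j f) :
    (IsFractionRing.den (MvPolynomial (Fin ℓ) ℂ) f : MvPolynomial (Fin ℓ) ℂ) ∣
      (eulerPoly i - eulerPoly j)
        (IsFractionRing.den (MvPolynomial (Fin ℓ) ℂ) f : MvPolynomial (Fin ℓ) ℂ) := by
  set n := IsFractionRing.num (MvPolynomial (Fin ℓ) ℂ) f with hn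
  set d := (IsFractionRing.den (MvPolynomial (Fin ℓ) ℂ) f : MvPolynomial (Fin ℓ) ℂ) with hd
  have h0 : f * algebraMap _ (RatA ℓ) d = algebraMap _ _ n := algebraMap_num_eq f
  have h1 : ∀ i, eulerRat i f * algebraMap _ _ d + f * algebraMap _ _ (eulerPoly i d)
      = algebraMap _ _ (eulerPoly i n) := by
    intro i
    rw [← eulerRat_algebraMap i n, ← h0, Derivation.leibniz, eulerRat_algebraMap]
    simp only [smul_eq_mul]
    ring
  have h2 : n * (eulerPoly i - eulerPoly j) d = (eulerPoly i - eulerPoly j) n * d := by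
    apply IsFractionRing.injective (MvPolynomial (Fin ℓ) ℂ) (RatA ℓ)
    rw [map_mul, map_mul, Derivation.sub_apply, Derivation.sub_apply, map_sub, map_sub, ← h1 i,
      ← h1 j, ← h0, h]
    ring
  exact (IsFractionRing.num_den_reduced (MvPolynomial (Fin ℓ) ℂ) f).symm.dvd_of_dvd_mul_left
    (Dvd.intro_left _ h2.symm)

lemma actA_monA (r : Fin ℓ → ℂ) (α : Fin ℓ → ℕ) (f : RatA ℓ) :
    actA r (Weyl.monA α) f = (∏ i, coordA i ^ α i) * f := by
  induction α using pi_nat_induction generalizing f with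
  | zero => simp [Weyl.monA, commMonomial_zero]
  | step α j ih =>
    rw [Weyl.monA_add_single, map_mul, Module.End.mul_apply, ih, actA_a, ← mul_assoc]
    congr 1
    simp only [Pi.add_apply, pow_add, Finset.prod_mul_distrib, Pi.single_apply, pow_ite, pow_one,
      pow_zero, Finset.prod_ite_eq', Finset.mem_univ, if_true]

end Restriction

/-! ### Equivariant functions -/

section Equivariant

variable {ℓ : ℕ} [NeZero ℓ]

lemma expo_succ {ε : ℂ} (hε : IsPrimitiveRoot ε ℓ) (c : Fin (ℓ - 1) → ℂ) (i : Fin ℓ) :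
    expo ε c (i + 1) = expo ε c i + coefC ε c (i + 1) := by
  rw [expo, expo, add_assoc]
  congr 1
  by_cases hi : (i : ℕ) + 1 < ℓ
  · have hv := Fin.val_add_one_of_lt' hi
    have : Finset.Iic (i + 1) = insert (i + 1) (Finset.Iic i) := by
      ext j
      simp only [Finset.mem_Iic, Finset.mem_insert, Fin.le_def, Fin.ext_iff, hv]
      omega
    rw [this, Finset.sum_insert, add_comm]
    simp [Fin.le_def, hv]
  · have h0 : i + 1 = 0 := by
      have h1 : (i : ℕ) + 1 = ℓ := by omega
      ext
      rw [Fin.val_add, Fin.val_one', Nat.add_mod_mod, h1]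
      simp
    have h1 : Finset.Iic i = Finset.univ := by
      ext j
      simp only [Finset.mem_Iic, Finset.mem_univ, iff_true, Fin.le_def]
      omega
    have h2 : Finset.Iic (0 : Fin ℓ) = {0} := by
      ext j
      simp
    rw [h0, h1, h2, sum_coefC hε, zero_add, Finset.sum_singleton]

/-- Summation by parts around the cycle, as `r_{i+1} - r_i = C_{i+1}`. It says that `∏ a_i^(r_i)`
already carries the whole weight `χ_c`, so the rational factor must be torus invariant. -/
lemma sum_sub_mul_expo {ε : ℂ} (hε : IsPrimitiveRoot ε ℓ) (c : Fin (ℓ - 1) → ℂ) (ξ : Fin ℓ → ℂ) :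
    ∑ i, (ξ i - ξ (i + 1)) * expo ε c i = chi ε c ξ := by
  have h1 := Equiv.sum_comp (Equiv.addRight (1 : Fin ℓ)) fun i => ξ i * expo ε c i
  have h2 := Equiv.sum_comp (Equiv.addRight (1 : Fin ℓ)) fun i => coefC ε c i * ξ i
  simp only [Equiv.coe_addRight] at h1 h2
  simp only [sub_mul, Finset.sum_sub_distrib]
  rw [← h1, chi, ← h2, ← Finset.sum_sub_distrib]
  refine Finset.sum_congr rfl fun i _ => ?_
  rw [expo_succ hε]
  ring

lemma actA_lieOp {ε : ℂ} (hε : IsPrimitiveRoot ε ℓ) (c : Fin (ℓ - 1) → ℂ) (ξ : Fin ℓ → ℂ)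
    (f : RatA ℓ) : actA (expo ε c) (lieOp ξ) f
      = ∑ i, (ξ i - ξ (i + 1)) • eulerRat i f + chi ε c ξ • f := by
  rw [lieOp_eq, map_sum, LinearMap.sum_apply, ← sum_sub_mul_expo hε, Finset.sum_smul,
    ← Finset.sum_add_distrib]
  refine Finset.sum_congr rfl fun i _ => ?_
  rw [map_smul, LinearMap.smul_apply, actA_euler, smul_add, mul_smul]

lemma mem_Fun_iff {ε : ℂ} (hε : IsPrimitiveRoot ε ℓ) (c : Fin (ℓ - 1) → ℂ) (f : RatA ℓ) :
    f ∈ Fun ε c ↔ ∀ i, eulerRat i f = eulerRat 0 f := by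
  simp only [Fun, Set.mem_ofPred_eq, actA_lieOp hε, add_eq_right]
  constructor
  · intro h
    refine eq_zero_apply_of_forall_eq (fun i => eulerRat i f) fun k => ?_
    have := h (Pi.single (k + 1) 1)
    simp only [sub_smul, Finset.sum_sub_distrib, Pi.single_apply, add_left_inj] at this
    simpa [sub_eq_zero] using this
  · intro h ξ
    have h1 := Equiv.sum_comp (Equiv.addRight (1 : Fin ℓ)) ξ
    simp only [Equiv.coe_addRight] at h1
    simp only [h]
    rw [← Finset.sum_smul, Finset.sum_sub_distrib, h1, sub_self, zero_smul]

/-- The exponents occurring in the denominator differ by multiples of `(1, …, 1)`, so their degrees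
are distinct and no cancellation occurs on the slice. Hence `resRat` never takes its default value
on equivariant functions. -/
lemma isRegular_of_mem_Fun {ε : ℂ} (hε : IsPrimitiveRoot ε ℓ) (c : Fin (ℓ - 1) → ℂ) {f : RatA ℓ}
    (hf : f ∈ Fun ε c) : IsRegular f := by
  rw [mem_Fun_iff hε] at hf
  refine resPoly_ne_zero (by simp) fun α hα β hβ hd => ?_
  have h1 : ∀ i, α i + β 0 = β i + α 0 := fun i => by
    have h2 := sub_eq_sub_of_dvd_eulerPoly_sub (den_dvd_eulerPoly_sub (hf i)) hα hβ
    rw [sub_eq_sub_iff_add_eq_add] at h2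
    exact_mod_cast h2
  have h2 : ∑ i, (α i + β 0) = ∑ i, (β i + α 0) := Finset.sum_congr rfl fun i _ => h1 i
  rw [Finset.sum_add_distrib, Finset.sum_add_distrib, ← Finsupp.degree_eq_sum,
    ← Finsupp.degree_eq_sum, hd] at h2
  have h3 : β 0 = α 0 := by
    simpa [NeZero.ne ℓ] using h2
  ext i
  have := h1 i
  omega

/-- All `a_i ∂_i` agree on `f`, so each is `1/ℓ` of their sum, which is tangent to the slice. -/
lemma resRat_eulerRat {ε : ℂ} (hε : IsPrimitiveRoot ε ℓ) (c : Fin (ℓ - 1) → ℂ) {f : RatA ℓ}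
    (hf : f ∈ Fun ε c) (i : Fin ℓ) (hi : IsRegular (eulerRat i f)) :
    resRat (eulerRat i f)
      = (ℓ : ℂ)⁻¹ • (coordX * fracDeriv (Polynomial.derivative' (R := ℂ)) (resRat f)) := by
  rw [← resRat_sum_eulerRat (isRegular_of_mem_Fun hε c hf)]
  have h : ∑ j, eulerRat j f = (ℓ : ℂ) • eulerRat i f := by
    have h1 := (mem_Fun_iff hε c f).1 hf
    simp [h1, Nat.cast_smul_eq_nsmul]
  rw [h, resRat_smul _ hi, smul_smul, inv_mul_cancel₀ (Nat.cast_ne_zero.2 (NeZero.ne ℓ)), one_smul]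

lemma actA_mem_Fun {ε : ℂ} {c : Fin (ℓ - 1) → ℂ} {D : Weyl (Fin ℓ)} (hD : D ∈ invariantOps ℓ)
    {f : RatA ℓ} (hf : f ∈ Fun ε c) : actA (expo ε c) D f ∈ Fun ε c := by
  intro ξ
  rw [← Module.End.mul_apply, ← map_mul, sub_eq_zero.1 ((mem_invariantOps_iff D).1 hD ξ), map_mul,
    Module.End.mul_apply, hf ξ, map_smul]

/-- The powers of `∏ a i` are equivariant. -/
lemma prod_coordA_pow {ε : ℂ} (hε : IsPrimitiveRoot ε ℓ) (c : Fin (ℓ - 1) → ℂ) (k : ℕ) :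
    (∏ i : Fin ℓ, coordA i) ^ k ∈ Fun ε c ∧
      resRat ((∏ i : Fin ℓ, coordA i) ^ k) = coordX ^ (ℓ * k) := by
  have h1 : (∏ i : Fin ℓ, coordA i) ^ k = algebraMap _ (RatA ℓ)
      (MvPolynomial.monomial (Finsupp.equivFunOnFinite.symm fun _ : Fin ℓ => k) (1 : ℂ)) := by
    rw [MvPolynomial.monomial_eq, Finsupp.prod_fintype _ _ (by simp)]
    simp [coordA, Finset.prod_pow]
  constructor
  · rw [mem_Fun_iff hε]
    intro i
    rw [h1, eulerRat_algebraMap, eulerRat_algebraMap, eulerPoly_monomial, eulerPoly_monomial]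
    rfl
  · rw [h1, (isRegular_and_resRat_algebraMap _).2, resPoly_monomial, Finsupp.degree_eq_sum, coordX,
      ← map_pow, Polynomial.X_pow_eq_monomial]
    simp

lemma IsRadialPart.unique {ε : ℂ} (hε : IsPrimitiveRoot ε ℓ) {c : Fin (ℓ - 1) → ℂ}
    {D : Weyl (Fin ℓ)} {E F : DReg} (hE : IsRadialPart ε c D E) (hF : IsRadialPart ε c D F) :
    E = F := by
  refine sub_eq_zero.1 (eq_zero_of_actX_coordX_pow (NeZero.ne ℓ) (∑ i, expo ε c i) fun k => ?_)
  obtain ⟨h1, h2⟩ := prod_coordA_pow hε c k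
  rw [← h2, map_sub, LinearMap.sub_apply, ← hE _ h1, ← hF _ h1, sub_self]

end Equivariant

/-! ### Radial parts of invariant differential operators -/

section RadialPairs

open Weyl

variable {ℓ : ℕ} [NeZero ℓ] {ε : ℂ}

lemma IsRadialPart.add (hε : IsPrimitiveRoot ε ℓ) {c : Fin (ℓ - 1) → ℂ} {D D' : Weyl (Fin ℓ)}
    {E E' : DReg} (hD : D ∈ invariantOps ℓ) (hD' : D' ∈ invariantOps ℓ)
    (h : IsRadialPart ε c D E) (h' : IsRadialPart ε c D' E') :
    IsRadialPart ε c (D + D') (E + E') := by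
  intro f hf
  rw [map_add, map_add, LinearMap.add_apply, LinearMap.add_apply,
    resRat_add (isRegular_of_mem_Fun hε c (actA_mem_Fun hD hf))
      (isRegular_of_mem_Fun hε c (actA_mem_Fun hD' hf)), h f hf, h' f hf]

lemma IsRadialPart.mul {c : Fin (ℓ - 1) → ℂ} {D D' : Weyl (Fin ℓ)}
    {E E' : DReg} (hD' : D' ∈ invariantOps ℓ)
    (h : IsRadialPart ε c D E) (h' : IsRadialPart ε c D' E') :
    IsRadialPart ε c (D * D') (E * E') := by
  intro f hf
  rw [map_mul, map_mul, Module.End.mul_apply, Module.End.mul_apply, h _ (actA_mem_Fun hD' hf),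
    h' f hf]

lemma isRadialPart_algebraMap (hε : IsPrimitiveRoot ε ℓ) (c : Fin (ℓ - 1) → ℂ) (z : ℂ) :
    IsRadialPart ε c (algebraMap ℂ _ z) (algebraMap ℂ _ z) := by
  intro f hf
  rw [AlgHom.commutes, AlgHom.commutes, Module.algebraMap_end_apply, Module.algebraMap_end_apply,
    resRat_smul _ (isRegular_of_mem_Fun hε c hf)]

/-- The pairs of an invariant differential operator and its radial part. -/
def radialPairs (hε : IsPrimitiveRoot ε ℓ) (c : Fin (ℓ - 1) → ℂ) :
    Subalgebra ℂ (Weyl (Fin ℓ) × DReg) where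
  carrier := {q | q.1 ∈ invariantOps ℓ ∧ IsRadialPart ε c q.1 q.2}
  add_mem' h h' := ⟨add_mem h.1 h'.1, h.2.add hε h.1 h'.1 h'.2⟩
  mul_mem' h h' := ⟨mul_mem h.1 h'.1, h.2.mul h'.1 h'.2⟩
  algebraMap_mem' z := ⟨Subalgebra.algebraMap_mem _ z, isRadialPart_algebraMap hε c z⟩

lemma invariantGens_subset : invariantGens ℓ ⊆ invariantOps ℓ := by
  rw [← adjoin_invariantGens]
  exact Algebra.subset_adjoin

lemma euler_mem_invariantOps (i : Fin ℓ) : euler i ∈ invariantOps ℓ :=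
  invariantGens_subset (Or.inr ⟨i, rfl⟩)

lemma monA_one_mem_invariantOps : monA 1 ∈ invariantOps ℓ :=
  invariantGens_subset (Or.inl (Or.inl rfl))

lemma monD_one_mem_invariantOps : monD 1 ∈ invariantOps ℓ :=
  invariantGens_subset (Or.inl (Or.inr rfl))

/-- This is what `σ` is normalized for: restrictions of equivariant functions carry no extra power
of `x`. -/
lemma sum_expo (hε : IsPrimitiveRoot ε ℓ) (c : Fin (ℓ - 1) → ℂ) : ∑ i, expo ε c i = 0 := by
  have hℓ : (ℓ : ℂ) ≠ 0 := Nat.cast_ne_zero.2 (NeZero.ne ℓ)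
  have h1 : ∑ i : Fin ℓ, ∑ j ∈ Finset.Iic i, coefC ε c j
      = ∑ j : Fin ℓ, ((ℓ : ℂ) - (j : ℕ)) * coefC ε c j := by
    rw [Finset.sum_comm' (t' := Finset.univ) (s' := fun j => Finset.Ici j) (by simp)]
    refine Finset.sum_congr rfl fun j _ => ?_
    rw [Finset.sum_const, Fin.card_Ici, nsmul_eq_mul, Nat.cast_sub j.2.le]
  simp only [expo, Finset.sum_add_distrib]
  rw [h1]
  simp only [sub_mul, Finset.sum_sub_distrib, ← Finset.mul_sum, sum_coefC hε, sigma,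
    Finset.sum_const, Finset.card_univ, Fintype.card_fin, nsmul_eq_mul]
  field_simp
  ring

lemma euler_mem_radialPairs (hε : IsPrimitiveRoot ε ℓ) (c : Fin (ℓ - 1) → ℂ) (i : Fin ℓ) :
    (euler i, (ℓ : ℂ)⁻¹ • DReg.euler + expo ε c i • 1) ∈ radialPairs hε c := by
  refine ⟨euler_mem_invariantOps i, fun f hf => ?_⟩
  -- Restriction is additive only on regular functions, so both summands of `a_i ∂_i f` are shown to
  -- be equivariant, as images of `f` under invariant operators.
  have h1 : eulerRat i f ∈ Fun ε c := by
    have h2 : euler i - expo ε c i • 1 ∈ invariantOps ℓ :=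
      sub_mem (euler_mem_invariantOps i) (Subalgebra.smul_mem _ (one_mem _) _)
    have h3 := actA_mem_Fun h2 hf
    rw [map_sub, map_smul, map_one, LinearMap.sub_apply, actA_euler, LinearMap.smul_apply,
      Module.End.one_apply, add_sub_cancel_right] at h3
    exact h3
  have h4 := isRegular_of_mem_Fun hε c h1
  have h5 := isRegular_of_mem_Fun hε c hf
  have h6 : IsRegular (expo ε c i • f) := isRegular_of_mem_Fun hε c (by
    have h2 : expo ε c i • 1 ∈ invariantOps ℓ := Subalgebra.smul_mem _ (one_mem _) _
    have h3 := actA_mem_Fun h2 hf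
    rwa [map_smul, map_one, LinearMap.smul_apply, Module.End.one_apply] at h3)
  rw [actA_euler, resRat_add h4 h6, resRat_smul _ h5, resRat_eulerRat hε c hf i h4, map_add,
    map_smul, map_smul, map_one, LinearMap.add_apply, LinearMap.smul_apply, LinearMap.smul_apply,
    actX_euler, sum_expo hε, zero_smul, add_zero, Module.End.one_apply]

lemma monA_one_mem_radialPairs (hε : IsPrimitiveRoot ε ℓ) (c : Fin (ℓ - 1) → ℂ) :
    (monA 1, DReg.x ^ ℓ) ∈ radialPairs hε c := by
  refine ⟨monA_one_mem_invariantOps, fun f hf => ?_⟩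
  obtain ⟨h1, h2⟩ := prod_coordA_pow hε c 1
  simp only [pow_one, mul_one] at h1 h2
  rw [actA_monA]
  simp only [Pi.one_apply, pow_one]
  rw [resRat_mul (isRegular_of_mem_Fun hε c h1) (isRegular_of_mem_Fun hε c hf), h2, actX_x_pow]

/-- The radial part of `∏ a i ∂ i` as a polynomial in `x ∂`. -/
def radialPoly (ε : ℂ) (c : Fin (ℓ - 1) → ℂ) : ℂ[X] :=
  ∏ i, (Polynomial.C (ℓ : ℂ)⁻¹ * Polynomial.X + Polynomial.C (expo ε c i))

lemma monA_mul_monD_mem_radialPairs (hε : IsPrimitiveRoot ε ℓ) (c : Fin (ℓ - 1) → ℂ) :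
    (monA 1 * monD 1, Polynomial.aeval DReg.euler (radialPoly ε c)) ∈ radialPairs hε c := by
  -- Indicator exponents let the factors `a_i ∂_i` enter one by one; the shift is zero because `i`
  -- is not yet in `s`.
  have key : ∀ s : Finset (Fin ℓ), (monA (fun i => if i ∈ s then 1 else 0)
      * monD (fun i => if i ∈ s then 1 else 0), Polynomial.aeval DReg.euler
        (∏ i ∈ s, (Polynomial.C (ℓ : ℂ)⁻¹ * Polynomial.X + Polynomial.C (expo ε c i))))
        ∈ radialPairs hε c := by
    intro s
    induction s using Finset.induction_on with
    | empty =>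
      have h0 : (fun _ => 0 : Fin ℓ → ℕ) = 0 := rfl
      simp only [Finset.notMem_empty, if_false, h0, monA, monD, commMonomial_zero,
        Finset.prod_empty, map_one, mul_one]
      exact one_mem (radialPairs hε c)
    | insert i s hi ih =>
      have h0 : (fun j => if j ∈ insert i s then 1 else 0 : Fin ℓ → ℕ)
          = (fun j => if j ∈ s then 1 else 0) + Pi.single i 1 := by
        ext j
        by_cases hj : j = i
        · subst hj; simp [hi]
        · simp [hj]
      rw [h0, monA_mul_monD_add_single, Finset.prod_insert hi, map_mul]
      have h1 := mul_mem (euler_mem_radialPairs hε c i) ih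
      rw [Prod.mk_mul_mk] at h1
      simp only [hi, if_false, Nat.cast_zero, zero_smul, sub_zero]
      convert h1 using 3
      simp [Algebra.smul_def]
  have h1 : (fun i => if i ∈ Finset.univ then 1 else 0 : Fin ℓ → ℕ) = 1 := by
    ext i
    simp
  have := key Finset.univ
  rwa [h1] at this

/-- The radial part of `∏ a_i ∏ ∂_i` is known, and that of `∏ a_i` is the invertible `x^ℓ`, which
can be divided out. -/
lemma monD_one_mem_radialPairs (hε : IsPrimitiveRoot ε ℓ) (c : Fin (ℓ - 1) → ℂ) :
    (monD 1, DReg.xinv ^ ℓ * Polynomial.aeval DReg.euler (radialPoly ε c))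
      ∈ radialPairs hε c := by
  refine ⟨monD_one_mem_invariantOps, fun f hf => ?_⟩
  have h1 := (monA_mul_monD_mem_radialPairs hε c).2 f hf
  rw [map_mul, Module.End.mul_apply, (monA_one_mem_radialPairs hε c).2 _
    (actA_mem_Fun monD_one_mem_invariantOps hf)] at h1
  rw [map_mul, Module.End.mul_apply, ← h1, ← Module.End.mul_apply, ← map_mul,
    DReg.xinv_pow_mul_x_pow, map_one, Module.End.one_apply]

/-- The generators of the algebra of radial pairs. -/
def radialPairGens (ε : ℂ) (c : Fin (ℓ - 1) → ℂ) : Set (Weyl (Fin ℓ) × DReg) :=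
  {(monA 1, DReg.x ^ ℓ), (monD 1, DReg.xinv ^ ℓ * Polynomial.aeval DReg.euler (radialPoly ε c))} ∪
    Set.range fun i => (euler i, (ℓ : ℂ)⁻¹ • DReg.euler + expo ε c i • 1)

lemma adjoin_radialPairGens_le (hε : IsPrimitiveRoot ε ℓ) (c : Fin (ℓ - 1) → ℂ) :
    Algebra.adjoin ℂ (radialPairGens ε c) ≤ radialPairs hε c := by
  refine Algebra.adjoin_le ?_
  rintro _ ((rfl | rfl) | ⟨i, rfl⟩)
  · exact monA_one_mem_radialPairs hε c
  · exact monD_one_mem_radialPairs hε c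
  · exact euler_mem_radialPairs hε c i

lemma map_fst_adjoin_radialPairGens (ε : ℂ) (c : Fin (ℓ - 1) → ℂ) :
    (Algebra.adjoin ℂ (radialPairGens ε c)).map (AlgHom.fst ℂ (Weyl (Fin ℓ)) DReg)
      = invariantOps ℓ := by
  rw [AlgHom.map_adjoin, ← adjoin_invariantGens, radialPairGens, invariantGens, Set.image_union,
    Set.image_pair, ← Set.range_comp]
  rfl

lemma exists_mem_adjoin_radialPairGens {ε : ℂ} (c : Fin (ℓ - 1) → ℂ) {D : Weyl (Fin ℓ)}
    (hD : D ∈ invariantOps ℓ) : ∃ E, (D, E) ∈ Algebra.adjoin ℂ (radialPairGens ε c) := by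
  rw [← map_fst_adjoin_radialPairGens ε c] at hD
  obtain ⟨⟨D, E⟩, h, rfl⟩ := hD
  exact ⟨E, h⟩

/-! ### Existence of radial parts and the image of the twisted map -/

lemma existsUnique_isRadialPart (hε : IsPrimitiveRoot ε ℓ) (c : Fin (ℓ - 1) → ℂ)
    {D : Weyl (Fin ℓ)} (hD : D ∈ invariantOps ℓ) : ∃! E : DReg, IsRadialPart ε c D E := by
  obtain ⟨E, hE⟩ := exists_mem_adjoin_radialPairGens (ε := ε) c hD
  have h := (adjoin_radialPairGens_le hε c hE).2
  exact ⟨E, h, fun F hF => hF.unique hε h⟩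

lemma radialPart_eq (hε : IsPrimitiveRoot ε ℓ) {c : Fin (ℓ - 1) → ℂ} {D : Weyl (Fin ℓ)} {E : DReg}
    (h : IsRadialPart ε c D E) : radialPart ε c D = E :=
  (Classical.epsilon_spec (p := IsRadialPart ε c D) ⟨E, h⟩).unique hε h

/-- The polynomial `∏ (X + ℓ ∑_{j ≤ i} C_j)`. -/
def dunklPoly (ε : ℂ) (c : Fin (ℓ - 1) → ℂ) : ℂ[X] :=
  ∏ i : Fin ℓ, (Polynomial.X + Polynomial.C ((ℓ : ℂ) * ∑ j ∈ Finset.Iic i, coefC ε c j))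

/-- The algebra generated by `x^ℓ`, `x ∂` and `x^(-ℓ) ∏ (x ∂ + ℓ ∑_{j ≤ i} C_j)`. -/
def sphericalImage (ε : ℂ) (c : Fin (ℓ - 1) → ℂ) : Subalgebra ℂ DReg :=
  Algebra.adjoin ℂ {DReg.x ^ ℓ, DReg.euler,
    DReg.xinv ^ ℓ * Polynomial.aeval DReg.euler (dunklPoly ε c)}

lemma conjPow_euler (μ : ℂ) : DReg.conjPow μ DReg.euler = DReg.euler + μ • 1 := by
  rw [DReg.euler, map_mul, DReg.conjPow, DReg.lift_x, DReg.lift_d, mul_add, mul_smul_comm,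
    DReg.x_mul_xinv]

lemma conjPow_radialGen (ε : ℂ) (c : Fin (ℓ - 1) → ℂ) (i : Fin ℓ) :
    DReg.conjPow (ℓ * sigma ε c) ((ℓ : ℂ)⁻¹ • DReg.euler + expo ε c i • 1)
      = (ℓ : ℂ)⁻¹ • DReg.euler + (∑ j ∈ Finset.Iic i, coefC ε c j) • 1 := by
  have hℓ : (ℓ : ℂ) ≠ 0 := Nat.cast_ne_zero.2 (NeZero.ne ℓ)
  rw [map_add, map_smul, map_smul, map_one, conjPow_euler, smul_add, smul_smul, add_assoc,
    ← add_smul, inv_mul_cancel_left₀ hℓ, expo, add_neg_cancel_left]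

/-- Conjugation shifts `x∂` by `ℓσ`, which cancels `-σ` in each `r_i`; the constant collects a
factor `1/ℓ` from each of the `ℓ` terms. -/
lemma conjPow_aeval_radialPoly (ε : ℂ) (c : Fin (ℓ - 1) → ℂ) :
    DReg.conjPow (ℓ * sigma ε c) (Polynomial.aeval DReg.euler (radialPoly ε c))
      = ((ℓ : ℂ)⁻¹ ^ ℓ) • Polynomial.aeval DReg.euler (dunklPoly ε c) := by
  have hℓ : (ℓ : ℂ) ≠ 0 := Nat.cast_ne_zero.2 (NeZero.ne ℓ)
  have h1 : ((ℓ : ℂ)⁻¹ ^ ℓ) • dunklPoly ε c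
      = (radialPoly ε c).comp (Polynomial.X + Polynomial.C (ℓ * sigma ε c)) := by
    rw [dunklPoly, radialPoly, Polynomial.prod_comp, Polynomial.smul_eq_C_mul, map_pow]
    have : (Polynomial.C (ℓ : ℂ)⁻¹) ^ ℓ = ∏ _i : Fin ℓ, Polynomial.C (ℓ : ℂ)⁻¹ := by simp
    rw [this, ← Finset.prod_mul_distrib]
    refine Finset.prod_congr rfl fun i _ => ?_
    simp only [Polynomial.add_comp, Polynomial.mul_comp, Polynomial.C_comp, Polynomial.X_comp,
      mul_add, ← Polynomial.C_mul, inv_mul_cancel_left₀ hℓ, add_assoc, ← Polynomial.C_add, expo,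
      add_neg_cancel_left]
  rw [← map_smul, h1, Polynomial.aeval_comp, ← Polynomial.aeval_algHom_apply, conjPow_euler, map_add,
    Polynomial.aeval_X, Polynomial.aeval_C, Algebra.algebraMap_eq_smul_one]

lemma map_conjPow_adjoin_radialPairGens (ε : ℂ) (c : Fin (ℓ - 1) → ℂ) :
    (Algebra.adjoin ℂ (radialPairGens ε c)).map
      ((DReg.conjPow (ℓ * sigma ε c)).comp (AlgHom.snd ℂ (Weyl (Fin ℓ)) DReg))
      = sphericalImage ε c := by
  have hℓ : (ℓ : ℂ) ≠ 0 := Nat.cast_ne_zero.2 (NeZero.ne ℓ)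
  have hP : DReg.conjPow (ℓ * sigma ε c)
      (DReg.xinv ^ ℓ * Polynomial.aeval DReg.euler (radialPoly ε c))
      = ((ℓ : ℂ)⁻¹ ^ ℓ) • (DReg.xinv ^ ℓ * Polynomial.aeval DReg.euler (dunklPoly ε c)) := by
    rw [map_mul, conjPow_aeval_radialPoly, map_pow, DReg.conjPow, DReg.lift_xinv, mul_smul_comm]
  have hx : DReg.conjPow (ℓ * sigma ε c) (DReg.x ^ ℓ) = DReg.x ^ ℓ := by
    rw [map_pow, DReg.conjPow, DReg.lift_x]
  rw [AlgHom.map_adjoin, sphericalImage]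
  apply le_antisymm
  · refine Algebra.adjoin_le ?_
    rintro _ ⟨_, (rfl | rfl) | ⟨i, rfl⟩, rfl⟩
    · refine Algebra.subset_adjoin (Or.inl ?_)
      exact hx
    · change DReg.conjPow (ℓ * sigma ε c)
        (DReg.xinv ^ ℓ * Polynomial.aeval DReg.euler (radialPoly ε c)) ∈ Algebra.adjoin ℂ _
      rw [hP]
      exact Subalgebra.smul_mem _ (Algebra.subset_adjoin (by simp)) _
    · change DReg.conjPow (ℓ * sigma ε c) ((ℓ : ℂ)⁻¹ • DReg.euler + expo ε c i • 1)
        ∈ Algebra.adjoin ℂ _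
      rw [conjPow_radialGen]
      exact add_mem (Subalgebra.smul_mem _ (Algebra.subset_adjoin (by simp)) _)
        (Subalgebra.smul_mem _ (one_mem _) _)
  · have hmem : ∀ q ∈ radialPairGens ε c, DReg.conjPow (ℓ * sigma ε c) q.2 ∈ Algebra.adjoin ℂ
        ((DReg.conjPow (ℓ * sigma ε c)).comp (AlgHom.snd ℂ (Weyl (Fin ℓ)) DReg) ''
          radialPairGens ε c) := fun q hq => Algebra.subset_adjoin ⟨q, hq, rfl⟩
    refine Algebra.adjoin_le ?_
    rintro _ (rfl | rfl | rfl)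
    · have := hmem _ (Or.inl (Or.inl rfl))
      rwa [hx] at this
    -- Any one index recovers `x∂`, after subtracting a constant and scaling by `ℓ`.
    · have := hmem _ (Or.inr ⟨0, rfl⟩)
      rw [conjPow_radialGen] at this
      have h1 := Subalgebra.smul_mem _ (sub_mem this (Subalgebra.smul_mem _ (one_mem _)
        (∑ j ∈ Finset.Iic (0 : Fin ℓ), coefC ε c j))) (ℓ : ℂ)
      rwa [add_sub_cancel_right, smul_smul, mul_inv_cancel₀ hℓ, one_smul] at h1
    · have := hmem _ (Or.inl (Or.inr rfl))
      rw [hP] at this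
      have h1 := Subalgebra.smul_mem _ this ((ℓ : ℂ) ^ ℓ)
      rwa [smul_smul, ← mul_pow, mul_inv_cancel₀ hℓ, one_pow, one_smul] at h1

/-- The image of the invariant differential operators under the twisted radial part map. -/
lemma image_twistedRadialPart (hε : IsPrimitiveRoot ε ℓ) (c : Fin (ℓ - 1) → ℂ) :
    twistedRadialPart ε c '' (invariantOps ℓ) = sphericalImage ε c := by
  have key : ∀ {D E}, (D, E) ∈ Algebra.adjoin ℂ (radialPairGens ε c) →
      D ∈ invariantOps ℓ ∧ twistedRadialPart ε c D = DReg.conjPow (ℓ * sigma ε c) E := by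
    intro D E h
    obtain ⟨h1, h2⟩ := adjoin_radialPairGens_le hε c h
    exact ⟨h1, by rw [twistedRadialPart, radialPart_eq hε h2]⟩
  rw [← map_conjPow_adjoin_radialPairGens]
  ext s
  constructor
  · rintro ⟨D, hD, rfl⟩
    obtain ⟨E, hE⟩ := exists_mem_adjoin_radialPairGens (ε := ε) c hD
    exact ⟨_, hE, (key hE).2.symm⟩
  · rintro ⟨⟨D, E⟩, hE, rfl⟩
    exact ⟨D, (key hE).1, (key hE).2⟩

end RadialPairs

/-! ### The image of the spherical subalgebra -/

section Spherical

open Smash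

lemma grp_mul_base_x {ℓ : ℕ} (γ : Gam ℓ) :
    (grp γ * base DReg.x : Smash DReg ℓ) = ((γ.val : ℂˣ) : ℂ) • (base DReg.x * grp γ) := by
  have hx : γ • DReg.x = ((γ.val : ℂˣ) : ℂ) • DReg.x := by
    simp [Gam.smul_DReg_def, DReg.rot]
  rw [grp_mul_base, hx, map_smul, smul_mul_assoc]

lemma grp_mul_base_x_pow {ℓ : ℕ} (γ : Gam ℓ) (a : ℕ) :
    (grp γ * base DReg.x ^ a : Smash DReg ℓ)
      = ((γ.val : ℂˣ) : ℂ) ^ a • (base DReg.x ^ a * grp γ) := by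
  induction a with
  | zero => simp
  | succ a ih =>
    rw [pow_succ, ← mul_assoc, ih, smul_mul_assoc, mul_assoc, grp_mul_base_x, mul_smul_comm,
      smul_smul, ← mul_assoc, ← pow_succ, ← pow_succ]

lemma Gam.val_pow_eq_one {ℓ : ℕ} (γ : Gam ℓ) : γ.val ^ ℓ = 1 :=
  (mem_rootsOfUnity ℓ (γ.val)).1 γ.2

lemma dunkl_denominator_ne_zero {ℓ : ℕ} {ε : ℂ} (hε : IsPrimitiveRoot ε ℓ) (m : Fin (ℓ - 1)) :
    ε ^ ((m : ℕ) + 1) - 1 ≠ 0 := by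
  intro h
  have h1 := (hε.pow_eq_one_iff_dvd _).1 (sub_eq_zero.1 h)
  have h2 := Nat.le_of_dvd (Nat.succ_pos _) h1
  have := m.2
  omega

variable {ℓ : ℕ} [NeZero ℓ] {ε : ℂ}

lemma Gam.card : Fintype.card (Gam ℓ) = ℓ := by
  rw [← Nat.card_eq_fintype_card]
  exact Complex.card_rootsOfUnity ℓ

lemma Smash.idem_mul_eq_self {v : Smash DReg ℓ} (h : ∀ γ : Gam ℓ, grp γ * v = v) :
    idem DReg * v = v := by
  rw [idem, smul_mul_assoc, Finset.sum_mul]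
  simp only [h]
  rw [Finset.sum_const, Finset.card_univ, Gam.card, ← Nat.cast_smul_eq_nsmul ℂ, smul_smul,
    inv_mul_cancel₀ (Nat.cast_ne_zero.2 (NeZero.ne ℓ)), one_smul]

lemma Smash.idem_mul_idem : (idem DReg : Smash DReg ℓ) * idem DReg = idem DReg :=
  idem_mul_eq_self grp_mul_idem

/-- The pairs `(u, s)` such that `u` commutes with `Γ` and `u e = s e`. -/
def sphericalPairs (ℓ : ℕ) [NeZero ℓ] : Subalgebra ℂ (Smash DReg ℓ × DReg) where
  carrier := {q | (∀ γ : Gam ℓ, grp γ * q.1 = q.1 * grp γ) ∧ q.1 * idem DReg = base q.2 * idem DReg}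
  add_mem' {p q} h h' := ⟨fun γ => by rw [Prod.fst_add, mul_add, add_mul, h.1, h'.1],
    by rw [Prod.fst_add, Prod.snd_add, map_add, add_mul, add_mul, h.2, h'.2]⟩
  mul_mem' {p q} h h' := by
    refine ⟨fun γ => by rw [Prod.fst_mul, ← mul_assoc, h.1, mul_assoc, h'.1, mul_assoc], ?_⟩
    -- Commuting with `e` is what makes `u e = s e` multiplicative: `u u' e = u e u' = s e u' = s u'
    -- e = s s' e`.
    have h1 : q.1 * idem DReg = idem DReg * q.1 := by
      rw [idem, mul_smul_comm, smul_mul_assoc, Finset.mul_sum, Finset.sum_mul]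
      simp only [h'.1]
    rw [Prod.fst_mul, Prod.snd_mul, map_mul, mul_assoc, h1, ← mul_assoc, h.2, mul_assoc, ← h1, h'.2,
      mul_assoc]
  algebraMap_mem' z := ⟨fun γ => (Algebra.commutes z _).symm, by
    rw [Prod.algebraMap_apply, AlgHom.commutes]⟩

/-! ### Spanning by the elements `x^a y^b e` -/

variable (hε : IsPrimitiveRoot ε ℓ) (c : Fin (ℓ - 1) → ℂ)

lemma grp_mul_dunkl_pow (γ : Gam ℓ) (b : ℕ) : grp γ * dunkl hε c ^ b
    = (((γ.val)⁻¹ : ℂˣ) : ℂ) ^ b • (dunkl hε c ^ b * grp γ) := by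
  induction b with
  | zero => simp
  | succ b ih =>
    rw [pow_succ, ← mul_assoc, ih, smul_mul_assoc, mul_assoc, grp_mul_dunkl, smul_mul_assoc,
      mul_smul_comm, smul_smul, ← mul_assoc, ← pow_succ, ← pow_succ]

/-- The elements `x^a y^b e` of `Γ ⋉ D(𝔱^reg)`, where `y` is the Dunkl operator. -/
def dunklMonomial (q : ℕ × ℕ) : Smash DReg ℓ :=
  base DReg.x ^ q.1 * dunkl hε c ^ q.2 * idem DReg

lemma grp_mul_dunklMonomial (γ : Gam ℓ) (a b : ℕ) :
    grp γ * dunklMonomial hε c (a, b)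
      = (((γ.val : ℂˣ) : ℂ) ^ a * (((γ.val)⁻¹ : ℂˣ) : ℂ) ^ b) • dunklMonomial hε c (a, b) := by
  rw [dunklMonomial, ← mul_assoc, ← mul_assoc, grp_mul_base_x_pow, smul_mul_assoc, smul_mul_assoc,
    mul_assoc _ (grp γ), grp_mul_dunkl_pow, mul_smul_comm, smul_mul_assoc, smul_smul, mul_assoc,
    mul_assoc, grp_mul_idem, mul_assoc]

/-- The span of the elements `x^a y^b e`. -/
def dunklSpan : Submodule ℂ (Smash DReg ℓ) := Submodule.span ℂ (Set.range (dunklMonomial hε c))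

lemma mul_mem_dunklSpan {u : Smash DReg ℓ}
    (h : ∀ a b, u * dunklMonomial hε c (a, b) ∈ dunklSpan hε c) {v : Smash DReg ℓ}
    (hv : v ∈ dunklSpan hε c) : u * v ∈ dunklSpan hε c := by
  have : dunklSpan hε c ≤ (dunklSpan hε c).comap (LinearMap.mulLeft ℂ u) := by
    conv_lhs => rw [dunklSpan]
    rw [Submodule.span_le]
    rintro _ ⟨⟨a, b⟩, rfl⟩
    exact h a b
  exact this hv

lemma dunklMonomial_mem (q : ℕ × ℕ) : dunklMonomial hε c q ∈ dunklSpan hε c :=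
  Submodule.subset_span ⟨q, rfl⟩

lemma grp_mul_mem_dunklSpan (γ : Gam ℓ) {v : Smash DReg ℓ} (hv : v ∈ dunklSpan hε c) :
    grp γ * v ∈ dunklSpan hε c := by
  refine mul_mem_dunklSpan hε c (fun a b => ?_) hv
  rw [grp_mul_dunklMonomial]
  exact Submodule.smul_mem _ _ (dunklMonomial_mem hε c _)

lemma base_x_mul_dunklMonomial (a b : ℕ) :
    base DReg.x * dunklMonomial hε c (a, b) = dunklMonomial hε c (a + 1, b) := by
  simp only [dunklMonomial, pow_succ', mul_assoc]

lemma base_x_mul_mem_dunklSpan {v : Smash DReg ℓ} (hv : v ∈ dunklSpan hε c) :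
    base DReg.x * v ∈ dunklSpan hε c := by
  refine mul_mem_dunklSpan hε c (fun a b => ?_) hv
  rw [base_x_mul_dunklMonomial]
  exact dunklMonomial_mem hε c _

/-- Moving `y` past `x` produces only group elements, which act on each `x^a y^b e` by a scalar. -/
lemma dunkl_mul_mem_dunklSpan {v : Smash DReg ℓ} (hv : v ∈ dunklSpan hε c) :
    dunkl hε c * v ∈ dunklSpan hε c := by
  refine mul_mem_dunklSpan hε c (fun a b => ?_) hv
  induction a with
  | zero =>
    have : dunkl hε c * dunklMonomial hε c (0, b) = dunklMonomial hε c (0, b + 1) := by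
      rw [dunklMonomial, dunklMonomial, pow_zero, one_mul, one_mul, pow_succ', mul_assoc]
    rw [this]
    exact dunklMonomial_mem hε c _
  | succ a ih =>
    rw [← base_x_mul_dunklMonomial, ← mul_assoc, sub_eq_iff_eq_add.1 (dunkl_comm hε c), add_mul,
      mul_assoc, add_mul, one_mul, Finset.sum_mul]
    refine add_mem (add_mem (dunklMonomial_mem hε c _) (sum_mem fun m _ => ?_))
      (base_x_mul_mem_dunklSpan hε c ih)
    rw [smul_mul_assoc]
    exact Submodule.smul_mem _ _ (grp_mul_mem_dunklSpan hε c _ (dunklMonomial_mem hε c _))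

lemma thetaTL_mul_mem_dunklSpan (t : TL) {v : Smash DReg ℓ} (hv : v ∈ dunklSpan hε c) :
    thetaTL hε c t * v ∈ dunklSpan hε c := by
  induction t using FreeAlgebra.induction generalizing v with
  | grade0 r =>
    rw [AlgHom.commutes, ← Algebra.smul_def]
    exact Submodule.smul_mem _ _ hv
  | grade1 g =>
    cases g
    · simpa [thetaTL] using base_x_mul_mem_dunklSpan hε c hv
    · simpa [thetaTL] using dunkl_mul_mem_dunklSpan hε c hv
  | mul a b ha hb =>
    rw [map_mul, mul_assoc]
    exact ha (hb hv)
  | add a b ha hb =>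
    rw [map_add, add_mul]
    exact add_mem (ha hv) (hb hv)

lemma Smash.eq_sum_base_mul_grp {A : Type} [Ring A] [MulSemiringAction (Gam ℓ) A] [Algebra ℂ A]
    [SMulCommClass (Gam ℓ) ℂ A] (w : Smash A ℓ) : w = ∑ γ : Gam ℓ, base (coeff γ w) * grp γ := by
  classical
  apply ext_coeff
  intro γ
  rw [map_sum]
  simp only [coeff_base_mul, coeff_grp, mul_ite, mul_one, mul_zero]
  rw [Finset.sum_ite_eq' Finset.univ γ, if_pos (Finset.mem_univ γ)]

/-- The spanning half of a PBW theorem for `H e`: group elements are absorbed by `e`. -/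
lemma theta_mul_idem_mem_dunklSpan (h : H hε c) : theta hε c h * idem DReg ∈ dunklSpan hε c := by
  obtain ⟨w, rfl⟩ := RingQuot.mkAlgHom_surjective ℂ (ChRel hε c) h
  rw [theta, RingQuot.liftAlgHom_mkAlgHom_apply, eq_sum_base_mul_grp w, map_sum, Finset.sum_mul]
  refine sum_mem fun γ _ => ?_
  rw [map_mul, thetaSmash, lift_base, lift_grp, mul_assoc, grp_mul_idem]
  refine thetaTL_mul_mem_dunklSpan hε c _ ?_
  simpa [dunklMonomial] using dunklMonomial_mem hε c (0, 0)

/-- The scalar by which `∑ c_m / (ε^m - 1) (α^m - 1)` acts on `y^k e`. -/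
def dunklScalar (ε : ℂ) (c : Fin (ℓ - 1) → ℂ) (k : ℕ) : ℂ :=
  ∑ m : Fin (ℓ - 1), c m / (ε ^ ((m : ℕ) + 1) - 1) * ((ε ^ ((m : ℕ) + 1))⁻¹ ^ k - 1)

lemma base_x_mul_dunkl_mul_dunkl_pow_mul_idem (k : ℕ) :
    base DReg.x * dunkl hε c * (dunkl hε c ^ k * idem DReg)
      = base (DReg.euler + dunklScalar ε c k • 1) * (dunkl hε c ^ k * idem DReg) := by
  have h1 : ∀ m : Fin (ℓ - 1), (grp (Gam.gen hε ^ ((m : ℕ) + 1)) - 1) * (dunkl hε c ^ k * idem DReg)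
      = ((ε ^ ((m : ℕ) + 1))⁻¹ ^ k - 1) • (dunkl hε c ^ k * idem DReg) := by
    intro m
    rw [sub_mul, one_mul, ← mul_assoc, grp_mul_dunkl_pow, smul_mul_assoc, mul_assoc, grp_mul_idem,
      sub_smul, one_smul, map_pow, Units.val_inv_eq_inv_val, Units.val_pow_eq_pow_val, Gam.val_gen]
  have h2 : base DReg.x * dunkl hε c = base DReg.euler + ∑ m : Fin (ℓ - 1),
      (c m / (ε ^ ((m : ℕ) + 1) - 1)) • (grp (Gam.gen hε ^ ((m : ℕ) + 1)) - 1) := by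
    rw [dunkl, mul_add, Finset.mul_sum, ← map_mul, ← DReg.euler]
    congr 1
    refine Finset.sum_congr rfl fun m _ => ?_
    rw [mul_smul_comm, ← mul_assoc, ← map_mul, DReg.x_mul_xinv, map_one, one_mul]
  rw [h2, add_mul, Finset.sum_mul, map_add, add_mul, map_smul, map_one, smul_mul_assoc, one_mul,
    dunklScalar, Finset.sum_smul]
  congr 1
  refine Finset.sum_congr rfl fun m _ => ?_
  rw [smul_mul_assoc, h1, smul_smul]

/-- The polynomial `∏_{k < a} (X + z_k - k)`. -/
def dunklPolyAux (ε : ℂ) (c : Fin (ℓ - 1) → ℂ) (a : ℕ) : ℂ[X] :=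
  ∏ k ∈ Finset.range a, (Polynomial.X + Polynomial.C (dunklScalar ε c k - k))

/-- In `x^a (xy) y^a e` the inner `xy` becomes `x∂ + z_a`; carrying `x^a` to its right lowers this
by `a`. -/
lemma dunklMonomial_diag (a : ℕ) : dunklMonomial hε c (a, a)
    = base (Polynomial.aeval DReg.euler (dunklPolyAux ε c a)) * idem DReg := by
  induction a with
  | zero => simp [dunklMonomial, dunklPolyAux]
  | succ a ih =>
    have h1 : DReg.x ^ a * (DReg.euler + dunklScalar ε c a • 1)
        = (DReg.euler + (dunklScalar ε c a - a) • 1) * DReg.x ^ a := by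
      rw [add_mul, DReg.euler_mul_x_pow]
      rw [mul_add, mul_add, smul_mul_assoc, one_mul, mul_smul_comm, mul_smul_comm, mul_one,
        add_assoc, ← add_smul, add_sub_cancel]
    rw [dunklMonomial, pow_succ, pow_succ', mul_assoc, mul_assoc, mul_assoc, ← mul_assoc (base _),
      base_x_mul_dunkl_mul_dunkl_pow_mul_idem, ← map_pow, ← mul_assoc, ← map_mul, h1, map_mul,
      mul_assoc, map_pow, ← mul_assoc _ _ (idem DReg), ← dunklMonomial.eq_1 hε c (a, a), ih,
      dunklPolyAux, dunklPolyAux, Finset.prod_range_succ_comm, map_mul (Polynomial.aeval DReg.euler),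
      map_add (Polynomial.aeval DReg.euler), Polynomial.aeval_X, Polynomial.aeval_C,
      Algebra.algebraMap_eq_smul_one, map_mul base, mul_assoc]

/-- The partial sums of the `C_j` contain geometric sums in `ε^m`, which creates the denominators
`ε^m - 1` of the Dunkl operator. -/
lemma mul_sum_coefC {ε : ℂ} (hε : IsPrimitiveRoot ε ℓ) (c : Fin (ℓ - 1) → ℂ) (i : Fin ℓ) :
    (ℓ : ℂ) * ∑ j ∈ Finset.Iic i, coefC ε c j = (i : ℕ) + 1 - ℓ + ∑ m : Fin (ℓ - 1), c m / (ε ^ ((m : ℕ) + 1) - 1)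
      * ((ε ^ ((m : ℕ) + 1)) ^ ((i : ℕ) + 1) - 1) := by
  have hℓ : (ℓ : ℂ) ≠ 0 := Nat.cast_ne_zero.2 (NeZero.ne ℓ)
  have hm := dunkl_denominator_ne_zero hε
  obtain ⟨n, hn⟩ := i
  induction n with
  | zero =>
    have h0 : Finset.Iic (⟨0, hn⟩ : Fin ℓ) = {0} := by
      ext j
      rw [Finset.mem_Iic, Finset.mem_singleton, Fin.le_def, Fin.ext_iff]
      exact Nat.le_zero
    have h1 : ∀ m : Fin (ℓ - 1), c m / (ε ^ ((m : ℕ) + 1) - 1) *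
        ((ε ^ ((m : ℕ) + 1)) ^ (0 + 1) - 1) = c m := fun m => by
      rw [zero_add, pow_one, div_mul_cancel₀ _ (hm m)]
    rw [h0, Finset.sum_singleton, coefC, if_pos rfl]
    simp only [h1]
    field_simp
    push_cast
    ring
  | succ n ih =>
    have h0 : (⟨n + 1, hn⟩ : Fin ℓ) = ⟨n, by omega⟩ + 1 := by
      ext
      exact (Fin.val_add_one_of_lt' (i := ⟨n, by omega⟩) hn).symm
    have h1 := expo_succ hε c ⟨n, by omega⟩
    rw [← h0, expo, expo, add_assoc, add_left_cancel_iff] at h1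
    have h2 : (⟨n + 1, hn⟩ : Fin ℓ) ≠ 0 := by simp [Fin.ext_iff]
    have h3 : (ℓ : ℂ) * coefC ε c ⟨n + 1, hn⟩ = 1 + ∑ m : Fin (ℓ - 1),
        ε ^ (((m : ℕ) + 1) * (n + 1)) * c m := by
      rw [coefC, if_neg h2]
      field_simp
    rw [h1, mul_add, ih, h3]
    have h4 : ∀ m : Fin (ℓ - 1), c m / (ε ^ ((m : ℕ) + 1) - 1) *
        ((ε ^ ((m : ℕ) + 1)) ^ (n + 1 + 1) - 1) = c m / (ε ^ ((m : ℕ) + 1) - 1) *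
        ((ε ^ ((m : ℕ) + 1)) ^ (n + 1) - 1) + ε ^ (((m : ℕ) + 1) * (n + 1)) * c m := by
      intro m
      have := hm m
      rw [pow_mul]
      field_simp
      ring
    simp only [h4, Finset.sum_add_distrib]
    push_cast
    ring

/-- Here the two sides meet. The factor `k = ℓ - 1 - i` of the Dunkl product is the factor `i` of
`dunklPoly`, because `ε^(-mk) = ε^(m(i+1))`. -/
lemma dunklPolyAux_self {ε : ℂ} (hε : IsPrimitiveRoot ε ℓ) (c : Fin (ℓ - 1) → ℂ) :
    dunklPolyAux ε c ℓ = dunklPoly ε c := by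
  rw [dunklPolyAux, dunklPoly, ← Finset.prod_range_reflect,
    ← Fin.prod_univ_eq_prod_range (fun k => Polynomial.X
      + Polynomial.C (dunklScalar ε c (ℓ - 1 - k) - ((ℓ - 1 - k : ℕ) : ℂ))) ℓ]
  refine Finset.prod_congr rfl fun i _ => ?_
  have hi := i.2
  congr 2
  rw [mul_sum_coefC hε, dunklScalar, Nat.sub_sub, Nat.cast_sub (by omega)]
  have h1 : ∀ m : Fin (ℓ - 1), (ε ^ ((m : ℕ) + 1))⁻¹ ^ (ℓ - (1 + (i : ℕ)))
      = (ε ^ ((m : ℕ) + 1)) ^ ((i : ℕ) + 1) := by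
    intro m
    rw [inv_pow]
    refine inv_eq_of_mul_eq_one_right ?_
    rw [← pow_add, ← pow_mul, mul_comm, pow_mul, show ℓ - (1 + (i : ℕ)) + (i + 1) = ℓ by omega,
      hε.pow_eq_one, one_pow]
  simp only [h1]
  push_cast
  ring

/-! ### Generators of the spherical image -/

lemma dunkl_pow_mem_sphericalPairs :
    (dunkl hε c ^ ℓ, DReg.xinv ^ ℓ * Polynomial.aeval DReg.euler (dunklPoly ε c))
      ∈ sphericalPairs ℓ := by
  refine ⟨fun γ => ?_, ?_⟩
  · rw [grp_mul_dunkl_pow, ← Units.val_pow_eq_pow_val, inv_pow, Gam.val_pow_eq_one, inv_one,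
      Units.val_one, one_smul]
  · rw [← dunklPolyAux_self hε c, map_mul, mul_assoc, ← dunklMonomial_diag, dunklMonomial, mul_assoc,
      ← mul_assoc, ← map_pow base DReg.x, ← map_mul, DReg.xinv_pow_mul_x_pow, map_one, one_mul]

lemma base_x_pow_mem_sphericalPairs (ℓ : ℕ) [NeZero ℓ] :
    (base DReg.x ^ ℓ, DReg.x ^ ℓ) ∈ sphericalPairs ℓ := by
  refine ⟨fun γ => ?_, by rw [map_pow]⟩
  rw [grp_mul_base_x_pow, ← Units.val_pow_eq_pow_val, Gam.val_pow_eq_one, Units.val_one, one_smul]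

lemma base_x_pow_mul_dunkl_pow_mem_sphericalPairs (a : ℕ) :
    (base DReg.x ^ a * dunkl hε c ^ a, Polynomial.aeval DReg.euler (dunklPolyAux ε c a))
      ∈ sphericalPairs ℓ := by
  refine ⟨fun γ => ?_, dunklMonomial_diag hε c a⟩
  rw [← mul_assoc, grp_mul_base_x_pow, smul_mul_assoc, mul_assoc, grp_mul_dunkl_pow, mul_smul_comm,
    smul_smul, ← Units.val_pow_eq_pow_val, ← Units.val_pow_eq_pow_val, ← Units.val_mul, ← mul_pow,
    mul_inv_cancel, one_pow, Units.val_one, one_smul, mul_assoc]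

lemma aeval_euler_mem_sphericalImage (ε : ℂ) (c : Fin (ℓ - 1) → ℂ) (p : ℂ[X]) :
    Polynomial.aeval DReg.euler p ∈ sphericalImage ε c :=
  Algebra.adjoin_mono (by simp) (Polynomial.aeval_mem_adjoin_singleton ℂ DReg.euler)

lemma x_pow_mem_sphericalImage (ε : ℂ) (c : Fin (ℓ - 1) → ℂ) : DReg.x ^ ℓ ∈ sphericalImage ε c :=
  Algebra.subset_adjoin (by simp)

lemma xinv_pow_mul_mem_sphericalImage (ε : ℂ) (c : Fin (ℓ - 1) → ℂ) :
    DReg.xinv ^ ℓ * Polynomial.aeval DReg.euler (dunklPoly ε c) ∈ sphericalImage ε c :=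
  Algebra.subset_adjoin (by simp)

lemma exists_dunklMonomial_eq {a b : ℕ} (h : a ≡ b [MOD ℓ]) :
    ∃ s ∈ sphericalImage ε c, dunklMonomial hε c (a, b) = base s * idem DReg := by
  rcases le_total a b with hab | hab
  · obtain ⟨k, hk⟩ := (Nat.modEq_iff_dvd' hab).1 h
    obtain rfl : b = a + ℓ * k := by omega
    refine ⟨_, mul_mem (aeval_euler_mem_sphericalImage ε c (dunklPolyAux ε c a))
      (pow_mem (xinv_pow_mul_mem_sphericalImage ε c) k), ?_⟩
    have := (mul_mem (base_x_pow_mul_dunkl_pow_mem_sphericalPairs hε c a)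
      (pow_mem (dunkl_pow_mem_sphericalPairs hε c) k)).2
    rw [dunklMonomial, pow_add, pow_mul, ← mul_assoc]
    exact this
  · obtain ⟨k, hk⟩ := (Nat.modEq_iff_dvd' hab).1 h.symm
    obtain rfl : a = ℓ * k + b := by omega
    refine ⟨_, mul_mem (pow_mem (x_pow_mem_sphericalImage ε c) k)
      (aeval_euler_mem_sphericalImage ε c (dunklPolyAux ε c b)), ?_⟩
    have := (mul_mem (pow_mem (base_x_pow_mem_sphericalPairs ℓ) k)
      (base_x_pow_mul_dunkl_pow_mem_sphericalPairs hε c b)).2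
    rw [dunklMonomial, pow_add, pow_mul, mul_assoc (_ ^ k)]
    exact this

lemma exists_idem_mul_dunklMonomial_eq (a b : ℕ) : ∃ s ∈ sphericalImage ε c,
    base s * idem DReg = idem DReg * dunklMonomial hε c (a, b) := by
  by_cases h : a ≡ b [MOD ℓ]
  · obtain ⟨s, hs, h1⟩ := exists_dunklMonomial_eq hε c h
    refine ⟨s, hs, ?_⟩
    rw [idem_mul_eq_self, h1]
    intro γ
    have h2 : γ.val ^ a = γ.val ^ b := by
      rw [← Nat.mod_add_div a ℓ, ← Nat.mod_add_div b ℓ, pow_add, pow_add, pow_mul, pow_mul,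
        Gam.val_pow_eq_one, one_pow, one_pow, h]
    rw [grp_mul_dunklMonomial, ← Units.val_pow_eq_pow_val, ← Units.val_pow_eq_pow_val,
      ← Units.val_mul, h2, ← mul_pow, mul_inv_cancel, one_pow, Units.val_one, one_smul]
  · refine ⟨0, zero_mem _, ?_⟩
    have h1 := congrArg (fun v => idem DReg * v) (grp_mul_dunklMonomial hε c (Gam.gen hε) a b)
    simp only [← mul_assoc, idem_mul_grp, mul_smul_comm] at h1
    -- The generator scales `x^a y^b e` by `ε^(a-b) ≠ 1`, while `e` absorbs it, so `e x^a y^b e =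
    -- 0`.
    have h2 : ε ^ a * ε⁻¹ ^ b - 1 ≠ 0 := by
      intro h0
      apply h
      have h0' : ε ≠ 0 := hε.ne_zero (NeZero.ne ℓ)
      rw [inv_pow, sub_eq_zero, mul_inv_eq_one₀ (pow_ne_zero _ h0')] at h0
      have hmod : ∀ n, ε ^ (n % ℓ) = ε ^ n := fun n => by
        conv_rhs => rw [← Nat.mod_add_div n ℓ, pow_add, pow_mul, hε.pow_eq_one, one_pow, mul_one]
      rw [← hmod a, ← hmod b] at h0
      have hpos := Nat.pos_of_ne_zero (NeZero.ne ℓ)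
      exact hε.pow_inj (Nat.mod_lt _ hpos) (Nat.mod_lt _ hpos) h0
    rw [map_zero, zero_mul]
    rw [Units.val_inv_eq_inv_val, Gam.val_gen, eq_comm, ← sub_eq_zero] at h1
    nth_rewrite 2 [← one_smul ℂ (idem DReg * dunklMonomial hε c (a, b))] at h1
    rw [← sub_smul] at h1
    exact ((smul_eq_zero_iff_right h2).1 h1).symm

lemma thetaSph_eq {u : H hε c} {s : DReg} (h : theta hε c u = base s * idem DReg) :
    thetaSph hε c u = s := by
  rw [thetaSph, h, coeff_base_mul, coeff_idem, mul_smul_comm, mul_one, smul_smul,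
    mul_inv_cancel₀ (Nat.cast_ne_zero.2 (NeZero.ne ℓ)), one_smul]

lemma thetaSph_mem_sphericalImage {u : H hε c} (hu : u ∈ spherical hε c) :
    thetaSph hε c u ∈ sphericalImage ε c := by
  obtain ⟨h, rfl⟩ := hu
  have h1 : dunklSpan hε c ≤ ((Subalgebra.toSubmodule (sphericalImage ε c)).map
      (LinearMap.mulRight ℂ (idem DReg : Smash DReg ℓ) ∘ₗ
        (base : DReg →ₐ[ℂ] Smash DReg ℓ).toLinearMap)).comap
        (LinearMap.mulLeft ℂ (idem DReg)) := by
    rw [dunklSpan, Submodule.span_le]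
    rintro _ ⟨⟨a, b⟩, rfl⟩
    exact exists_idem_mul_dunklMonomial_eq hε c a b
  obtain ⟨s, hs, h2⟩ := h1 (theta_mul_idem_mem_dunklSpan hε c h)
  have h3 : theta hε c (idemH hε c * h * idemH hε c) = base s * idem DReg := by
    rw [map_mul, map_mul, theta_idem, mul_assoc]
    exact h2.symm
  beta_reduce
  rw [thetaSph_eq hε c h3]
  exact hs

/-- The image of the spherical subalgebra under the spherical Dunkl map. -/
lemma image_thetaSph : thetaSph hε c '' spherical hε c = sphericalImage ε c := by
  apply Set.Subset.antisymm
  · rintro _ ⟨u, hu, rfl⟩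
    exact thetaSph_mem_sphericalImage hε c hu
  · set Q : Subalgebra ℂ (H hε c × DReg) := (sphericalPairs ℓ).comap
      (AlgHom.prodMap (theta hε c) (AlgHom.id ℂ DReg)) with hQ
    have hθ : ∀ t : TL, theta hε c (RingQuot.mkAlgHom ℂ (ChRel hε c) (base t)) = thetaTL hε c t := by
      intro t
      rw [theta, RingQuot.liftAlgHom_mkAlgHom_apply, thetaSmash, lift_base]
    set X := RingQuot.mkAlgHom ℂ (ChRel hε c) (base (FreeAlgebra.ι ℂ XY.x)) with hX
    set Y := RingQuot.mkAlgHom ℂ (ChRel hε c) (base (FreeAlgebra.ι ℂ XY.y)) with hY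
    have hX' : theta hε c X = base DReg.x := by rw [hX, hθ]; simp [thetaTL]
    have hY' : theta hε c Y = dunkl hε c := by rw [hY, hθ]; simp [thetaTL]
    -- The generators lift to `X^ℓ`, `XY` and `Y^ℓ`, whose images under `Θ_c` commute with `Γ`. For
    -- such a lift `h` one has `Θ_c(e h e) = Θ_c(h) e`.
    have key : sphericalImage ε c ≤ Q.map (AlgHom.snd ℂ (H hε c) DReg) := by
      refine Algebra.adjoin_le ?_
      rintro _ (rfl | rfl | rfl)
      · refine ⟨(X ^ ℓ, _), ?_, rfl⟩
        change (theta hε c (X ^ ℓ), DReg.x ^ ℓ) ∈ sphericalPairs ℓ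
        rw [map_pow, hX']
        exact base_x_pow_mem_sphericalPairs ℓ
      · refine ⟨(X * Y, _), ?_, rfl⟩
        change (theta hε c (X * Y), DReg.euler) ∈ sphericalPairs ℓ
        rw [map_mul, hX', hY']
        -- The scalar `z_0` is zero, so the product for `a = 1` is just `X`.
        simpa [dunklPolyAux, dunklScalar] using base_x_pow_mul_dunkl_pow_mem_sphericalPairs hε c 1
      · refine ⟨(Y ^ ℓ, _), ?_, rfl⟩
        change (theta hε c (Y ^ ℓ), _) ∈ sphericalPairs ℓ
        rw [map_pow, hY']
        exact dunkl_pow_mem_sphericalPairs hε c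
    intro s hs
    obtain ⟨⟨h, s⟩, hq, rfl⟩ := key hs
    refine ⟨idemH hε c * h * idemH hε c, ⟨h, rfl⟩, thetaSph_eq hε c ?_⟩
    have h1 : theta hε c h * idem DReg = idem DReg * theta hε c h := by
      rw [idem, mul_smul_comm, smul_mul_assoc, Finset.mul_sum, Finset.sum_mul]
      exact congrArg _ (Finset.sum_congr rfl fun γ _ => (hq.1 γ).symm)
    rw [map_mul, map_mul, theta_idem, ← h1, mul_assoc, idem_mul_idem]
    exact hq.2

end Spherical

end CyclicQuiver

end

theorem mainTheorem3 (ℓ : ℕ) [NeZero ℓ] (ε : ℂ) (hε : IsPrimitiveRoot ε ℓ)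
    (c : Fin (ℓ - 1) → ℂ) :
    (∀ D ∈ CyclicQuiver.invariantOps ℓ,
      ∃! E : CyclicQuiver.DReg, CyclicQuiver.IsRadialPart ε c D E) ∧
    CyclicQuiver.twistedRadialPart ε c '' (CyclicQuiver.invariantOps ℓ) =
      CyclicQuiver.thetaSph hε c '' CyclicQuiver.spherical hε c :=
  ⟨fun _ hD => CyclicQuiver.existsUnique_isRadialPart hε c hD, by
    rw [CyclicQuiver.image_twistedRadialPart hε, CyclicQuiver.image_thetaSph]⟩
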